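/- Let $K$ be a field with algebraic closure $\overline K$. A variety in $\mathbb{A}^n$ is the set of common zeros in $\overline K^n$ of a system of polynomials in $n$ variables with coefficients in $\overline K$; a nonempty variety is irreducible if it is not the union of two proper subvarieties, and the irreducible components of a variety are its maximal irreducible subvarieties. The dimension of an irreducible variety $V$ is the largest $d$ such that there is a chain $V_0\subsetneq V_1\subsetneq\dots\subsetneq V_d=V$ of irreducible varieties, and its degree is the number of points in which it meets a generic plane of dimension $n-d$. Let $r\ge 0$, and let $d_1,\dots,d_r$ and $N_1,\dots,N_r$ be natural numbers. Then there are a natural number $k$ and a real number $c>0$, depending only on $r$, $(d_i)_{i\le r}$ and $(N_i)_{i\le r}$, such that the following holds. Let $K$ be any field, $n\ge 0$, and let $G$ be a group acting linearly on $\mathbb{A}^n$ over $K$, i.e. through a homomorphism $\phi:G\to \mathrm{GL}_n(K)$. Let $W\subsetneq\mathbb{A}^n$ be a proper subvariety with exactly $r$ irreducible components, which have dimensions $d_1,\dots,d_r$ and degrees $N_1,\dots,N_r$, respectively. Let $A$ be a finite set of generators of $G$ with $A=A^{-1}$ and $e\in A$. Let $x\in\mathbb{A}^n(\overline K)$ be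 a point whose orbit $G\cdot x$ is not contained in $W$. Then there are at least $\max(1,c|A|)$ elements $g\in A^k=\{a_1a_2\cdots a_k : a_i\in A\}$ such that $gx\notin W$. -/

import Mathlib

open scoped Pointwise MatrixGroups

namespace EscapeSubvar

/-- `V ⊆ Lⁿ` is an affine variety: the set of common zeros in `Lⁿ` of a system of polynomials
with coefficients in `L`. It is applied with `L` algebraically closed, so that a variety
is identified with its set of points over `L`. -/
def IsVariety {L : Type*} [Field L] {n : ℕ} (V : Set (Fin n → L)) : Prop :=
  ∃ S : Set (MvPolynomial (Fin n) L), V = {x | ∀ p ∈ S, MvPolynomial.eval x p = 0}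

/-- An irreducible affine variety: nonempty and not the union of two proper subvarieties. -/
def IsIrreducibleVariety {L : Type*} [Field L] {n : ℕ} (V : Set (Fin n → L)) : Prop :=
  IsVariety V ∧ V.Nonempty ∧
    ∀ V₁ V₂ : Set (Fin n → L), IsVariety V₁ → IsVariety V₂ → V = V₁ ∪ V₂ → V₁ = V ∨ V₂ = V

/-- The irreducible subvarieties of affine `n`-space over `L`, ordered by inclusion. -/
abbrev IrreducibleVariety (L : Type*) [Field L] (n : ℕ) : Type _ :=
  {V : Set (Fin n → L) // IsIrreducibleVariety V}

/-- The irreducible components of `W`: its maximal irreducible subvarieties. -/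
def components {L : Type*} [Field L] {n : ℕ} (W : Set (Fin n → L)) :
    Set (IrreducibleVariety L n) :=
  {V | Maximal (fun V : IrreducibleVariety L n => V.1 ⊆ W) V}

/-- The dimension of an irreducible variety: the largest `d` for which there is a strictly
increasing chain `V₀ ⊂ V₁ ⊂ ⋯ ⊂ V_d = V` of irreducible varieties. -/
noncomputable def dim {L : Type*} [Field L] {n : ℕ} (V : IrreducibleVariety L n) : ℕ∞ :=
  Order.height V

/-- `V`, a variety of pure dimension `d` in affine `n`-space, has degree `N`: it meets a generic
plane of dimension `n - d` in exactly `N` points. Planes are given by `d` affine linear equations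
`M y = b`; generic means that it holds for all `(M, b)` in the nonempty Zariski open set
`P(M, b) ≠ 0`, for some nonzero polynomial `P` in the coefficients. -/
def HasDegree {L : Type*} [Field L] {n : ℕ} (V : Set (Fin n → L)) (d N : ℕ) : Prop :=
  ∃ P : MvPolynomial ((Fin d × Fin n) ⊕ Fin d) L, P ≠ 0 ∧
    ∀ (M : Matrix (Fin d) (Fin n) L) (b : Fin d → L),
      MvPolynomial.eval (Sum.elim (fun ij => M ij.1 ij.2) b) P ≠ 0 →
        {y | y ∈ V ∧ M.mulVec y = b}.encard = (N : ℕ∞)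

/-- `W` has exactly `r` irreducible components, which can be numbered in such a way that the
`i`-th one has dimension `d i` and degree `N i`. -/
def HasComponentInvariants {L : Type*} [Field L] {n : ℕ} (W : Set (Fin n → L))
    (r : ℕ) (d N : Fin r → ℕ) : Prop :=
  ∃ V : Fin r → IrreducibleVariety L n, Function.Injective V ∧ Set.range V = components W ∧
    ∀ i, dim (V i) = (d i : ℕ∞) ∧ HasDegree (V i).1 (d i) (N i)

/-- The action of `g` on a point `x` of affine `n`-space (with coordinates in the algebraic
closure of `K`), for a linear action `φ : G → GL_n(K)`. -/
noncomputable def act {K : Type*} [Field K] {G : Type*} [Group G] {n : ℕ}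
    (φ : G →* GL (Fin n) K) (g : G) (x : Fin n → AlgebraicClosure K) :
    Fin n → AlgebraicClosure K :=
  ((φ g : Matrix (Fin n) (Fin n) K).map (algebraMap K (AlgebraicClosure K))).mulVec x

end EscapeSubvar

namespace EscapeSubvar

open MvPolynomial

/-! ### Krull dimension under integral ring homomorphisms. -/

section IntegralDimension

variable {A B : Type*} [CommRing A] [CommRing B]

/-! Escape is linear algebra in a space of polynomial functions. Let `D` be the sum of the degrees
`N i`, let `P` be the polynomial functions of degree at most `D`, and let `I` be those in `P`
vanishing on `W`. If `I` cuts out `W` and has codimension at most `m` in `P`, then a sum of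
translates of `I` can grow at most `m` times inside the `G`-stable space `P`. So at most `m + 1`
elements of `A ^ m` give translates whose sum contains every translate of `I`
(`exists_finset_forall_map_le`). If these elements all send `y` into `W`, the whole orbit of `y`
lies in `W`. Applying this to `y = a x` for each `a ∈ A` gives `s a * a` in `A ^ (m + 1)` escaping
`W`, and `a ↦ s a * a` is at most `(m + 1)`-to-one.

The geometric content is that `D` suffices and that `m` does not depend on `n`. Both follow from one
fact about an irreducible `V` of dimension `d` and degree `N`: any `d + 1` linear forms on `V`
satisfy a relation of degree at most `N` (`exists_totalDegree_le_linSubst_mem`). For a generic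
finite projection, the image of `V` is a hypersurface. A generic line meets it in as many points as
its degree, and these lift to distinct points of a generic plane section of `V`. Arbitrary linear
forms follow because independence of monomials on the image is an open condition.

Projecting so that a point `q` outside `V` stays off the image gives an equation of degree at most
`N` that is nonzero at `q` (`exists_totalDegree_le_mem_eval_ne_zero`). Lifting a grid of `(N + 1) ^
d` points to `V` bounds the space of linear forms on `V`, hence the functions of degree at most `D`
on `V` (`exists_finset_linear_eq_zero`, `finrank_map_restrictFun_affineFunctions_pow_le`). -/

theorem ringKrullDim_le_of_isIntegral (f : A →+* B) (hf : f.IsIntegral) :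
    ringKrullDim B ≤ ringKrullDim A := by
  algebraize [f]
  refine Order.krullDim_le_of_strictMono (PrimeSpectrum.comap (algebraMap A B)) fun p q hpq => ?_
  exact Ideal.IsIntegral.comap_lt_comap (R := A) hpq

theorem ringKrullDim_le_of_isIntegral_of_injective (f : A →+* B) (hf : f.IsIntegral)
    (hinj : Function.Injective f) : ringKrullDim A ≤ ringKrullDim B := by
  algebraize [f]
  refine iSup_le fun l => ?_
  obtain ⟨P, hP, hPl⟩ := Ideal.exists_ideal_over_prime_of_isIntegral (R := A) (S := B)
    l.head.asIdeal ⊥ (by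
      rw [← RingHom.ker_eq_comap_bot,
        (RingHom.injective_iff_ker_eq_bot (algebraMap A B)).1 hinj]
      exact bot_le)
  obtain ⟨hPprime, hPc⟩ := hPl
  have : P.LiesOver l.head.asIdeal := ⟨hPc.symm⟩
  obtain ⟨l', hl', -⟩ := Ideal.exists_ltSeries_of_hasGoingUp (S := B) l P
  rw [← hl']
  exact le_iSup (fun l : LTSeries (PrimeSpectrum B) => (l.length : WithBot ℕ∞)) l'

/-- Dividing `A` by `F` and then by a `G` not divisible by `F` would lower the dimension twice,
while integrality allows a drop of only one. Geometrically, a finite image of codimension one lying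
in an irreducible hypersurface is all of it. -/
theorem dvd_of_mem_ker_of_isIntegral [IsDomain A] (f : A →+* B) (hf : f.IsIntegral) {d : ℕ}
    (hA : ringKrullDim A = (d + 1 : ℕ)) (hB : ringKrullDim B = d) {F : A} (hF : Prime F)
    (hfF : f F = 0) {G : A} (hG : f G = 0) : F ∣ G := by
  by_contra hdvd
  have hp : (Ideal.span {F}).IsPrime := (Ideal.span_singleton_prime hF.ne_zero).2 hF
  have h0 : ringKrullDim (A ⧸ Ideal.span {F}) + 1 ≤ ringKrullDim A :=
    ringKrullDim_quotient_succ_le_of_nonZeroDivisor (mem_nonZeroDivisors_of_ne_zero hF.ne_zero)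
  let g : A ⧸ Ideal.span {F} →+* B := Ideal.Quotient.lift _ f fun a ha => by
    obtain ⟨b, rfl⟩ := Ideal.mem_span_singleton.1 ha
    simp [hfF]
  have hg : g.IsIntegral := by
    refine RingHom.IsIntegral.tower_top (Ideal.Quotient.mk _) g ?_
    convert hf
    exact RingHom.ext fun _ => rfl
  have hG0 : Ideal.Quotient.mk (Ideal.span {F}) G ≠ 0 := by
    rwa [Ne, Ideal.Quotient.eq_zero_iff_mem, Ideal.mem_span_singleton]
  have h1 : ringKrullDim g.range + 1 ≤ ringKrullDim (A ⧸ Ideal.span {F}) :=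
    ringKrullDim_succ_le_of_surjective g.rangeRestrict g.rangeRestrict_surjective
      (mem_nonZeroDivisors_of_ne_zero hG0) (by
        apply Subtype.ext
        simpa [g] using hG)
  have h2 : ringKrullDim B ≤ ringKrullDim g.range :=
    ringKrullDim_le_of_isIntegral g.range.subtype
      (RingHom.IsIntegral.tower_top g.rangeRestrict g.range.subtype hg)
  have h3 : ((d : WithBot ℕ∞) + 1) + 1 ≤ ((d + 1 : ℕ) : WithBot ℕ∞) := by
    rw [← hA, ← hB]
    exact (add_le_add_left ((add_le_add_left h2 1).trans h1) 1).trans h0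
  norm_cast at h3
  omega

theorem injective_of_isIntegral [IsDomain A] (f : A →+* B) (hf : f.IsIntegral) {d : ℕ}
    (hA : ringKrullDim A = d) (hB : ringKrullDim B = d) : Function.Injective f := by
  rw [injective_iff_map_eq_zero]
  intro G hG
  by_contra hG0
  have h1 : ringKrullDim f.range + 1 ≤ ringKrullDim A :=
    ringKrullDim_succ_le_of_surjective f.rangeRestrict f.rangeRestrict_surjective
      (mem_nonZeroDivisors_of_ne_zero hG0) (Subtype.ext hG)
  have h2 : ringKrullDim B ≤ ringKrullDim f.range :=
    ringKrullDim_le_of_isIntegral f.range.subtype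
      (RingHom.IsIntegral.tower_top f.rangeRestrict f.range.subtype hf)
  have h3 : ((d : WithBot ℕ∞) + 1) ≤ (d : WithBot ℕ∞) := by
    nth_rw 1 [← hB]
    rw [← hA]
    exact (add_le_add_left h2 1).trans h1
  norm_cast at h3
  omega

end IntegralDimension

/-! ### Linear projections of affine varieties and their images. -/

section Projection

variable {L : Type*} [Field L] {m n : ℕ}

/-- The homomorphism of polynomial rings that corresponds to the linear map `x ↦ Λ x`. -/
noncomputable def linSubst (Λ : Matrix (Fin m) (Fin n) L) :
    MvPolynomial (Fin m) L →ₐ[L] MvPolynomial (Fin n) L :=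
  aeval fun i => ∑ j, C (Λ i j) * X j

theorem eval_linSubst (Λ : Matrix (Fin m) (Fin n) L) (x : Fin n → L)
    (F : MvPolynomial (Fin m) L) : eval x (linSubst Λ F) = eval (Λ.mulVec x) F := by
  have h : (aeval x).comp (linSubst Λ) =
      (aeval (Λ.mulVec x) : MvPolynomial (Fin m) L →ₐ[L] L) := by
    ext i
    simp [linSubst, Matrix.mulVec, dotProduct]
  simpa [aeval_eq_eval] using congr($h F)

theorem linSubst_X (Λ : Matrix (Fin m) (Fin n) L) (i : Fin m) :
    linSubst Λ (X i) = ∑ j, C (Λ i j) * X j := by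
  simp [linSubst]

/-- The homomorphism from the coordinate ring of `m`-space to the coordinate ring of the zero
locus of `I` that corresponds to the linear map `x ↦ Λ x`. -/
noncomputable def projHom (I : Ideal (MvPolynomial (Fin n) L)) (Λ : Matrix (Fin m) (Fin n) L) :
    MvPolynomial (Fin m) L →+* MvPolynomial (Fin n) L ⧸ I :=
  (Ideal.Quotient.mk I).comp (linSubst Λ).toRingHom

theorem projHom_eq_zero {I : Ideal (MvPolynomial (Fin n) L)} {Λ : Matrix (Fin m) (Fin n) L}
    {F : MvPolynomial (Fin m) L} : projHom I Λ F = 0 ↔ linSubst Λ F ∈ I :=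
  Ideal.Quotient.eq_zero_iff_mem

theorem ringKrullDim_mvPolynomial_fin (m : ℕ) :
    ringKrullDim (MvPolynomial (Fin m) L) = m := by
  simp

variable {I : Ideal (MvPolynomial (Fin n) L)} {Λ : Matrix (Fin m) (Fin n) L}

theorem exists_ne_zero_linSubst_mem (hΛ : (projHom I Λ).IsIntegral) {d : ℕ}
    (hd : ringKrullDim (MvPolynomial (Fin n) L ⧸ I) = d) (hm : d < m) :
    ∃ F, F ≠ 0 ∧ linSubst Λ F ∈ I := by
  by_contra! h
  have hinj : Function.Injective (projHom I Λ) := by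
    rw [injective_iff_map_eq_zero]
    intro F hF
    by_contra hF0
    exact h F hF0 (projHom_eq_zero.1 hF)
  have := ringKrullDim_le_of_isIntegral_of_injective _ hΛ hinj
  rw [ringKrullDim_mvPolynomial_fin, hd] at this
  norm_cast at this
  omega

/-- Factor `F`: since `I` is prime, some irreducible factor already vanishes on the image. -/
theorem exists_irreducible_dvd_linSubst_mem [hI : I.IsPrime] {F : MvPolynomial (Fin m) L}
    (hF : F ≠ 0) (hFI : linSubst Λ F ∈ I) :
    ∃ F', Irreducible F' ∧ F' ∣ F ∧ linSubst Λ F' ∈ I := by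
  induction F using WfDvdMonoid.induction_on_irreducible with
  | zero => exact absurd rfl hF
  | unit u hu =>
    exact absurd (Ideal.eq_top_of_isUnit_mem _ hFI (hu.map (linSubst Λ))) hI.ne_top
  | mul a i ha hi ih =>
    rw [map_mul] at hFI
    rcases hI.mem_or_mem hFI with h | h
    · exact ⟨i, hi, dvd_mul_right _ _, h⟩
    · obtain ⟨F', h1, h2, h3⟩ := ih ha h
      exact ⟨F', h1, h2.mul_left _, h3⟩

/-- A finite projection has closed image: lying over gives a maximal ideal above that of `p`, and
the Nullstellensatz turns it into a point. -/
theorem exists_mem_zeroLocus_mulVec_eq [IsAlgClosed L] (hΛ : (projHom I Λ).IsIntegral)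
    {p : Fin m → L} (hp : ∀ F, linSubst Λ F ∈ I → eval p F = 0) :
    ∃ x ∈ zeroLocus L I, Λ.mulVec x = p := by
  have hmax : (vanishingIdeal L {p} : Ideal (MvPolynomial (Fin m) L)).IsMaximal := inferInstance
  let := (projHom I Λ).toAlgebra
  have : Algebra.IsIntegral (MvPolynomial (Fin m) L) (MvPolynomial (Fin n) L ⧸ I) := ⟨hΛ⟩
  obtain ⟨Q, hQ, hQp⟩ := Ideal.exists_ideal_over_maximal_of_isIntegral
    (S := MvPolynomial (Fin n) L ⧸ I) (vanishingIdeal L {p} : Ideal (MvPolynomial (Fin m) L)) (by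
      intro F hF
      rw [mem_vanishingIdeal_singleton_iff]
      simpa [aeval_eq_eval] using hp F (projHom_eq_zero.1 hF))
  have hQ' : (Q.comap (Ideal.Quotient.mk I)).IsMaximal :=
    Ideal.comap_isMaximal_of_surjective _ Ideal.Quotient.mk_surjective
  obtain ⟨x, hx⟩ := eq_vanishingIdeal_singleton_of_isMaximal L hQ'
  have key : ∀ F, F ∈ Q.comap (Ideal.Quotient.mk I) ↔ eval x F = 0 := fun F => by
    rw [hx, mem_vanishingIdeal_singleton_iff, aeval_eq_eval]
  refine ⟨x, fun F hF => ?_, ?_⟩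
  · rw [aeval_eq_eval]
    refine (key F).1 ?_
    rw [Ideal.mem_comap, Ideal.Quotient.eq_zero_iff_mem.2 hF]
    exact Q.zero_mem
  · ext i
    have h1 : (X i - C (p i) : MvPolynomial (Fin m) L) ∈ Q.comap (projHom I Λ) := by
      have : (X i - C (p i) : MvPolynomial (Fin m) L) ∈
          (vanishingIdeal L {p} : Ideal (MvPolynomial (Fin m) L)) := by
        rw [mem_vanishingIdeal_singleton_iff]; simp
      rw [← hQp] at this
      exact this
    have h2 := (key (linSubst Λ (X i - C (p i)))).1 h1
    rw [eval_linSubst] at h2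
    simpa [sub_eq_zero] using h2

theorem exists_mem_zeroLocus_of_irreducible [IsAlgClosed L] {d : ℕ}
    {Λ : Matrix (Fin (d + 1)) (Fin n) L} (hΛ : (projHom I Λ).IsIntegral)
    (hd : ringKrullDim (MvPolynomial (Fin n) L ⧸ I) = d) {F : MvPolynomial (Fin (d + 1)) L}
    (hF : Irreducible F) (hFI : linSubst Λ F ∈ I) {p : Fin (d + 1) → L} (hp : eval p F = 0) :
    ∃ x ∈ zeroLocus L I, Λ.mulVec x = p := by
  refine exists_mem_zeroLocus_mulVec_eq hΛ fun G hG => ?_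
  obtain ⟨H, rfl⟩ := dvd_of_mem_ker_of_isIntegral _ hΛ (ringKrullDim_mvPolynomial_fin _) hd
    hF.prime (projHom_eq_zero.2 hFI) (projHom_eq_zero.2 hG)
  simp [hp]

theorem exists_mem_zeroLocus_of_dim_eq [IsAlgClosed L]
    (hΛ : (projHom I Λ).IsIntegral)
    (hd : ringKrullDim (MvPolynomial (Fin n) L ⧸ I) = m) (p : Fin m → L) :
    ∃ x ∈ zeroLocus L I, Λ.mulVec x = p := by
  refine exists_mem_zeroLocus_mulVec_eq hΛ fun G hG => ?_
  have := injective_of_isIntegral _ hΛ (ringKrullDim_mvPolynomial_fin _) hd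
  rw [(injective_iff_map_eq_zero _).1 this G (projHom_eq_zero.2 hG), map_zero]

end Projection

/-! ### Irreducible polynomials over algebraically closed fields have a nonzero partial derivative.
-/

section Separability

variable {L : Type*} [Field L] [IsAlgClosed L] {σ : Type*}

theorem exists_pderiv_ne_zero_of_irreducible {F : MvPolynomial σ L} (hF : Irreducible F) :
    ∃ i, pderiv i F ≠ 0 := by
  by_contra! h
  have hs : ∀ s ∈ F.support, ∀ i, ((s i : ℕ) : L) = 0 := by
    intro s hs i
    rcases Nat.eq_zero_or_pos (s i) with h0 | h0
    · simp [h0]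
    · have hle : Finsupp.single i 1 ≤ s := by
        simpa [Nat.one_le_iff_ne_zero] using h0.ne'
      have := coeff_pderiv (i := i) F (s - Finsupp.single i 1)
      rw [h i, coeff_zero, tsub_add_cancel_of_le hle] at this
      have h1 : s i - 1 + 1 = s i := Nat.sub_add_cancel h0
      rcases mul_eq_zero.1 this.symm with h2 | h2
      · exact absurd h2 (mem_support_iff.1 hs)
      · rw [← h1]
        simpa using h2
  obtain ⟨p, hp⟩ := CharP.exists L
  rcases CharP.char_is_prime_or_zero L p with hprime | rfl
  · have : Fact p.Prime := ⟨hprime⟩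
    choose r hr using fun c : L => IsAlgClosed.exists_pow_nat_eq c hprime.pos
    -- In characteristic `p` all exponents are divisible by `p` and all coefficients are `p`-th
    -- powers, so `F` is a `p`-th power.
    have hFp : F = (∑ s ∈ F.support,
        monomial (s.mapRange (· / p) (Nat.zero_div p)) (r (coeff s F))) ^ p := by
      rw [sum_pow_char]
      conv_lhs => rw [F.as_sum]
      refine Finset.sum_congr rfl fun s hs' => ?_
      rw [monomial_pow, hr]
      congr 2
      ext i
      simp only [Finsupp.coe_smul, Pi.smul_apply, Finsupp.mapRange_apply, smul_eq_mul]
      exact (Nat.mul_div_cancel' ((CharP.cast_eq_zero_iff L p _).1 (hs s hs' i))).symm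
    rw [hFp] at hF
    exact hprime.one_lt.ne' (by
      by_contra hne
      exact not_irreducible_pow hne hF)
  · have : CharZero L := CharP.charP_to_charZero L
    have hFC : F = C (coeff 0 F) := by
      classical
      ext s
      rw [coeff_C]
      split_ifs with h0
      · rw [h0]
      · by_contra hne
        exact h0 (Finsupp.ext fun i =>
          (Nat.cast_eq_zero.1 (hs s (mem_support_iff.2 hne) i)).symm)
    have hc : coeff 0 F ≠ 0 := fun h0 => hF.ne_zero (by rw [hFC, h0, C_0])
    exact hF.not_isUnit (hFC ▸ (isUnit_iff_ne_zero.2 hc).map C)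

end Separability

/-! ### Restriction of polynomials to families of parallel lines. -/

section LineSubst

variable {L : Type*} [Field L] {m : ℕ}

/-- Restriction of a polynomial function on `(m + 1)`-space to the lines of direction `(1, v)`,
where the line through `(0, b)` is parametrized by `t ↦ (t, b + t v)`. -/
noncomputable def lineSubst (v : Fin m → L) :
    MvPolynomial (Fin (m + 1)) L →ₐ[L] Polynomial (MvPolynomial (Fin m) L) :=
  aeval (Fin.cons Polynomial.X fun i =>
    Polynomial.C (X i) + Polynomial.C (C (v i)) * Polynomial.X)

@[simp]
theorem lineSubst_X_zero (v : Fin m → L) : lineSubst v (X 0) = Polynomial.X := by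
  simp [lineSubst]

@[simp]
theorem lineSubst_X_succ (v : Fin m → L) (i : Fin m) :
    lineSubst v (X i.succ) = Polynomial.C (X i) + Polynomial.C (C (v i)) * Polynomial.X := by
  simp [lineSubst]

@[simp]
theorem lineSubst_C (v : Fin m → L) (c : L) :
    lineSubst v (C c) = Polynomial.C (C c) := by
  simp [lineSubst, Polynomial.C_eq_algebraMap, IsScalarTower.algebraMap_apply L
    (MvPolynomial (Fin m) L) (Polynomial (MvPolynomial (Fin m) L)), algebraMap_eq]

theorem lineSubst_monomial (v : Fin m → L) (s : Fin (m + 1) →₀ ℕ) (c : L) :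
    (lineSubst v (monomial s c)).natDegree ≤ s.degree ∧
      (lineSubst v (monomial s c)).coeff s.degree =
        C (eval (Fin.cons 1 v : Fin (m + 1) → L) (monomial s c)) := by
  have key : ∀ s : Fin (m + 1) →₀ ℕ, (lineSubst v (monomial s 1)).natDegree ≤ s.degree ∧
      (lineSubst v (monomial s 1)).coeff s.degree =
        C (eval (Fin.cons 1 v : Fin (m + 1) → L) (monomial s 1)) := by
    intro s
    induction s using Finsupp.induction_linear with
    | zero => simp
    | add s t hs ht =>
      have h : (monomial (s + t) (1 : L)) = monomial s 1 * monomial t 1 := by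
        rw [monomial_mul, one_mul]
      rw [h, map_mul, map_mul, map_mul, map_add]
      refine ⟨Polynomial.natDegree_mul_le.trans (add_le_add hs.1 ht.1), ?_⟩
      rw [Polynomial.coeff_mul_add_eq_of_natDegree_le hs.1 ht.1, hs.2, ht.2]
    | single i a =>
      have h : (monomial (Finsupp.single i a) (1 : L)) = X i ^ a := by
        rw [X_pow_eq_monomial]
      have hX : (lineSubst v (X i)).natDegree ≤ 1 ∧ (lineSubst v (X i)).coeff 1 =
          C ((Fin.cons 1 v : Fin (m + 1) → L) i) := by
        refine Fin.cases ?_ (fun i => ?_) i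
        · simp
        · simp only [lineSubst_X_succ, Fin.cons_succ]
          refine ⟨by compute_degree, by simp⟩
      rw [h, map_pow, map_pow, map_pow, Finsupp.degree_single, eval_X, ← hX.2]
      refine ⟨Polynomial.natDegree_pow_le.trans ?_, ?_⟩
      · simpa using Nat.mul_le_mul_left a hX.1
      · simpa using Polynomial.coeff_pow_of_natDegree_le (m := a) hX.1
  have h : monomial s c = C c * monomial s 1 := by rw [C_mul_monomial, mul_one]
  rw [h, map_mul, map_mul, map_mul, lineSubst_C, eval_C, Polynomial.coeff_C_mul, (key s).2]
  exact ⟨(Polynomial.natDegree_C_mul_le _ _).trans (key s).1, rfl⟩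

theorem natDegree_lineSubst_le (v : Fin m → L) (F : MvPolynomial (Fin (m + 1)) L) :
    (lineSubst v F).natDegree ≤ F.totalDegree := by
  conv_lhs => rw [F.as_sum, map_sum]
  refine Polynomial.natDegree_sum_le_of_forall_le _ _ fun s hs => ?_
  exact (lineSubst_monomial v s _).1.trans (le_totalDegree hs)

/-- Only the top-degree form contributes to this power of `t`, through its value at the direction
`(1, v)`. For generic `v` the degree on every line of the family is therefore the total degree. -/
theorem coeff_totalDegree_lineSubst (v : Fin m → L) (F : MvPolynomial (Fin (m + 1)) L) :
    (lineSubst v F).coeff F.totalDegree =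
      C (eval (Fin.cons 1 v : Fin (m + 1) → L) (homogeneousComponent F.totalDegree F)) := by
  conv_lhs => rw [F.as_sum, map_sum, Polynomial.finsetSum_coeff]
  rw [homogeneousComponent_apply, map_sum, map_sum, Finset.sum_filter]
  refine Finset.sum_congr rfl fun s hs => ?_
  have h := lineSubst_monomial v s (coeff s F)
  rw [← F.as_sum]
  split_ifs with hd
  · rw [← hd, h.2]
  · refine Polynomial.coeff_eq_zero_of_natDegree_lt (h.1.trans_lt ?_)
    exact lt_of_le_of_ne (le_totalDegree hs) hd

theorem eval_lineSubst (v b : Fin m → L) (t : L) (F : MvPolynomial (Fin (m + 1)) L) :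
    ((lineSubst v F).map (eval b)).eval t =
      eval (Fin.cons t (fun i => b i + v i * t) : Fin (m + 1) → L) F := by
  induction F using MvPolynomial.induction_on with
  | C a => simp
  | add p q hp hq => simp [hp, hq]
  | mul_X p i hp =>
    rw [map_mul, Polynomial.map_mul, Polynomial.eval_mul, hp, map_mul]
    congr 1
    refine Fin.cases ?_ (fun i => ?_) i <;> simp

theorem derivative_lineSubst (v : Fin m → L) (F : MvPolynomial (Fin (m + 1)) L) :
    Polynomial.derivative (lineSubst v F) =
      lineSubst v (pderiv 0 F + ∑ i : Fin m, C (v i) * pderiv i.succ F) := by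
  induction F using MvPolynomial.induction_on with
  | C a => simp
  | add p q hp hq =>
    simp only [map_add, hp, hq, mul_add, Finset.sum_add_distrib]
    ring
  | mul_X p i hp =>
    have h : Polynomial.derivative (lineSubst v (X i)) =
        lineSubst v (pderiv 0 (X i) + ∑ j : Fin m, C (v j) * pderiv j.succ (X i)) := by
      refine Fin.cases ?_ (fun i => ?_) i
      · simp [pderiv_X_of_ne (Fin.succ_ne_zero _).symm]
      · rw [pderiv_X_of_ne (Fin.succ_ne_zero _), Finset.sum_eq_single i]
        · simp
        · intro j _ hj
          rw [pderiv_X_of_ne (fun h => hj (Fin.succ_injective _ h).symm), mul_zero]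
        · simp
    rw [map_mul, Polynomial.derivative_mul, hp, h, ← map_mul, ← map_mul, ← map_add]
    congr 1
    simp only [pderiv_mul, mul_add, add_mul, Finset.sum_add_distrib, Finset.sum_mul,
      Finset.mul_sum]
    have h1 : ∀ j : Fin m, C (v j) * (pderiv j.succ p * X i) = C (v j) * pderiv j.succ p * X i :=
      fun j => by ring
    have h2 : ∀ j : Fin m, C (v j) * (p * pderiv j.succ (X i)) = p * (C (v j) * pderiv j.succ (X i)) :=
      fun j => by ring
    simp only [h1, h2]
    ring

/-- The shear `(t, b) ↦ (t, b + t v)`, as a substitution. -/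
noncomputable def shear (v : Fin m → L) :
    MvPolynomial (Fin (m + 1)) L →ₐ[L] MvPolynomial (Fin (m + 1)) L :=
  aeval (Fin.cons (X 0) fun i => X i.succ + C (v i) * X 0)

theorem shear_comp_shear_neg (v : Fin m → L) :
    (shear v).comp (shear (-v)) = AlgHom.id L (MvPolynomial (Fin (m + 1)) L) := by
  ext1 i
  refine Fin.cases ?_ (fun i => ?_) i
  · simp [shear]
  · simp [shear, algHom_C]

/-- `lineSubst v` is a shear, an automorphism, followed by the isomorphism `finSuccEquiv`. -/
theorem irreducible_lineSubst (v : Fin m → L) {F : MvPolynomial (Fin (m + 1)) L}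
    (hF : Irreducible F) : Irreducible (lineSubst v F) := by
  let e : MvPolynomial (Fin (m + 1)) L ≃ₐ[L] MvPolynomial (Fin (m + 1)) L :=
    AlgEquiv.ofAlgHom (shear v) (shear (-v)) (shear_comp_shear_neg v)
      (by simpa using shear_comp_shear_neg (-v))
  have h : lineSubst v = (e.trans (finSuccEquiv L m) :
      MvPolynomial (Fin (m + 1)) L →ₐ[L] Polynomial (MvPolynomial (Fin m) L)) := by
    ext1 i
    refine Fin.cases ?_ (fun i => ?_) i
    · simp [e, shear, finSuccEquiv_X_zero]
    · have hC : finSuccEquiv L m (C (v i)) = Polynomial.C (C (v i)) := by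
        rw [finSuccEquiv_apply]; simp
      simp [e, shear, finSuccEquiv_X_succ, finSuccEquiv_X_zero, hC]
  rw [h]
  exact hF.map (e.trans (finSuccEquiv L m))

theorem eval_smul_of_isHomogeneous {σ : Type*} [Fintype σ] {H : MvPolynomial σ L} {D : ℕ}
    (hH : H.IsHomogeneous D) (c : L) (x : σ → L) : eval (c • x) H = c ^ D * eval x H := by
  rw [eval_eq', eval_eq', Finset.mul_sum]
  refine Finset.sum_congr rfl fun s hs => ?_
  have h : ∑ i, s i = D := by
    rw [← Finsupp.degree_eq_sum, Finsupp.degree_eq_weight_one]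
    exact hH (mem_support_iff.1 hs)
  simp only [Pi.smul_apply, smul_eq_mul, mul_pow, Finset.prod_mul_distrib,
    Finset.prod_pow_eq_pow_sum, h]
  ring

theorem exists_ne_zero_eval_eq_eval_cons [Infinite L] {H : MvPolynomial (Fin (m + 1)) L} {D : ℕ}
    (hH : H.IsHomogeneous D) (h0 : H ≠ 0) :
    ∃ T : MvPolynomial (Fin m) L, T ≠ 0 ∧
      ∀ v, eval v T = eval (Fin.cons 1 v : Fin (m + 1) → L) H := by
  have heval : ∀ v : Fin m → L, eval v (aeval (Fin.cons 1 X : Fin (m + 1) → MvPolynomial _ L) H) =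
      eval (Fin.cons 1 v : Fin (m + 1) → L) H := by
    intro v
    have : (aeval v).comp (aeval (Fin.cons 1 X : Fin (m + 1) → MvPolynomial _ L)) =
        (aeval (Fin.cons 1 v : Fin (m + 1) → L) : MvPolynomial (Fin (m + 1)) L →ₐ[L] L) := by
      ext1 i
      refine Fin.cases ?_ (fun i => ?_) i <;> simp
    simpa [aeval_eq_eval] using congr($this H)
  refine ⟨_, fun h => ?_, heval⟩
  -- By homogeneity `H` vanishes wherever the first coordinate is nonzero; the factor `X 0` covers
  -- the remaining points.
  have hmul : H * X 0 = 0 := by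
    refine MvPolynomial.funext fun x => ?_
    rw [map_mul, eval_X, map_zero]
    by_cases hx : x 0 = 0
    · rw [hx, mul_zero]
    · have hx' : x = x 0 • (Fin.cons 1 fun i : Fin m => (x 0)⁻¹ * x i.succ) := by
        ext i
        refine Fin.cases ?_ (fun i => ?_) i
        · simp
        · simp [hx]
      have h1 : eval x H = x 0 ^ D * eval (Fin.cons 1 fun i : Fin m => (x 0)⁻¹ * x i.succ) H := by
        conv_lhs => rw [hx']
        rw [eval_smul_of_isHomogeneous hH]
      rw [h1, ← heval, h, map_zero, mul_zero, zero_mul]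
  rcases mul_eq_zero.1 hmul with h1 | h1
  · exact h0 h1
  · exact X_ne_zero _ h1

end LineSubst

/-! ### Noether normalization by generic linear projections. -/

section Normalization

variable {L : Type*} [Field L] {m n : ℕ}

theorem isIntegral_of_isIntegralElem_X {R : Type*} [CommRing R] {k : ℕ}
    (f : MvPolynomial (Fin m) L →+* R) (g : MvPolynomial (Fin k) L →+* R) (hg : g.IsIntegral)
    (hC : ∀ c, g (C c) = f (C c)) (hX : ∀ i, f.IsIntegralElem (g (X i))) : f.IsIntegral := by
  let := f.toAlgebra
  have hmem : ∀ p, g p ∈ integralClosure (MvPolynomial (Fin m) L) R := by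
    intro p
    induction p using MvPolynomial.induction_on with
    | C c =>
      rw [hC]
      exact isIntegral_algebraMap (R := MvPolynomial (Fin m) L) (A := R) (x := C c)
    | add p q hp hq => rw [map_add]; exact add_mem hp hq
    | mul_X p i hp => rw [map_mul]; exact mul_mem hp (hX i)
  let g' : MvPolynomial (Fin k) L →+* integralClosure (MvPolynomial (Fin m) L) R :=
    g.codRestrict (integralClosure (MvPolynomial (Fin m) L) R) hmem
  have h1 : (algebraMap (integralClosure (MvPolynomial (Fin m) L) R) R).IsIntegral :=
    RingHom.IsIntegral.tower_top g' _ hg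
  have h2 : (algebraMap (MvPolynomial (Fin m) L)
      (integralClosure (MvPolynomial (Fin m) L) R)).IsIntegral :=
    fun x => (integralClosure.AlgebraIsIntegral).isIntegral x
  exact RingHom.IsIntegral.trans _ _ h2 h1

theorem linSubst_one : linSubst (1 : Matrix (Fin n) (Fin n) L) = AlgHom.id L _ := by
  ext1 i
  simp [linSubst_X, Matrix.one_apply]

theorem linSubst_linSubst {k : ℕ} (Λ : Matrix (Fin m) (Fin n) L) (Λ' : Matrix (Fin k) (Fin m) L)
    (F : MvPolynomial (Fin k) L) : linSubst Λ (linSubst Λ' F) = linSubst (Λ' * Λ) F := by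
  have h : (linSubst Λ).comp (linSubst Λ') = linSubst (Λ' * Λ) := by
    ext1 i
    simp only [AlgHom.comp_apply, linSubst_X, map_sum, map_mul, algHom_C, algebraMap_eq,
      Matrix.mul_apply, Finset.mul_sum, Finset.sum_mul]
    rw [Finset.sum_comm]
    refine Finset.sum_congr rfl fun j _ => Finset.sum_congr rfl fun l _ => by ring
  exact congr($h F)

theorem linSubst_C (Λ : Matrix (Fin m) (Fin n) L) (c : L) : linSubst Λ (C c) = C c := by
  simp [linSubst]

variable {I : Ideal (MvPolynomial (Fin n) L)}

theorem isIntegral_projHom_of_leftInverse {Λ : Matrix (Fin m) (Fin n) L}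
    {Λ' : Matrix (Fin n) (Fin m) L} (h : Λ' * Λ = 1) : (projHom I Λ).IsIntegral := by
  refine RingHom.isIntegral_of_surjective _ fun r => ?_
  obtain ⟨F, rfl⟩ := Ideal.Quotient.mk_surjective r
  refine ⟨linSubst Λ' F, ?_⟩
  change Ideal.Quotient.mk I (linSubst Λ (linSubst Λ' F)) = _
  rw [linSubst_linSubst, h, linSubst_one, AlgHom.id_apply]

/-- The composition of `Λ` with the projection of `(m + 1)`-space along `(1, v)`. -/
def projAlong (v : Fin m → L) (Λ : Matrix (Fin (m + 1)) (Fin n) L) : Matrix (Fin m) (Fin n) L :=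
  Matrix.of fun i j => Λ i.succ j - v i * Λ 0 j

theorem projAlong_mulVec (v : Fin m → L) (Λ : Matrix (Fin (m + 1)) (Fin n) L) (x : Fin n → L)
    (i : Fin m) : (projAlong v Λ).mulVec x i = Λ.mulVec x i.succ - v i * Λ.mulVec x 0 := by
  simp [projAlong, Matrix.mulVec, dotProduct, sub_mul, Finset.sum_sub_distrib, Finset.mul_sum,
    mul_assoc]

theorem linSubst_projAlong_X (v : Fin m → L) (Λ : Matrix (Fin (m + 1)) (Fin n) L) (i : Fin m) :
    linSubst (projAlong v Λ) (X i) = linSubst Λ (X i.succ) - C (v i) * linSubst Λ (X 0) := by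
  simp [linSubst_X, projAlong, sub_mul, Finset.sum_sub_distrib, Finset.mul_sum, mul_assoc]

/-- The point `Λ x` lies on the line of direction `(1, v)` through `(0, projAlong v Λ x)`, at the
parameter given by its first coordinate. -/
theorem eval₂_lineSubst (v : Fin m → L) (Λ : Matrix (Fin (m + 1)) (Fin n) L)
    (F : MvPolynomial (Fin (m + 1)) L) :
    (lineSubst v F).eval₂ (linSubst (projAlong v Λ)).toRingHom (linSubst Λ (X 0)) =
      linSubst Λ F := by
  induction F using MvPolynomial.induction_on with
  | C a => simp
  | add p q hp hq => rw [map_add, Polynomial.eval₂_add, hp, hq, map_add]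
  | mul_X p i hp =>
    rw [map_mul, Polynomial.eval₂_mul, hp, map_mul]
    congr 1
    refine Fin.cases ?_ (fun i => ?_) i
    · simp
    · simp [linSubst_projAlong_X]

/-- When `(1, v)` is not a zero of the leading form of `F`, the relation `F`, restricted to lines
and rescaled, is a monic equation for the coordinate that the projection forgets. -/
theorem isIntegral_projHom_projAlong {v : Fin m → L} {Λ : Matrix (Fin (m + 1)) (Fin n) L}
    (hΛ : (projHom I Λ).IsIntegral) {F : MvPolynomial (Fin (m + 1)) L} (hF : linSubst Λ F ∈ I)
    (hv : eval (Fin.cons 1 v : Fin (m + 1) → L) (homogeneousComponent F.totalDegree F) ≠ 0) :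
    (projHom I (projAlong v Λ)).IsIntegral := by
  set c := eval (Fin.cons 1 v : Fin (m + 1) → L) (homogeneousComponent F.totalDegree F) with hc
  have hz : (projHom I (projAlong v Λ)).IsIntegralElem (projHom I Λ (X 0)) := by
    refine ⟨Polynomial.C (C c⁻¹) * lineSubst v F, ?_, ?_⟩
    · refine Polynomial.monic_of_natDegree_le_of_coeff_eq_one F.totalDegree
        ((Polynomial.natDegree_C_mul_le _ _).trans (natDegree_lineSubst_le v F)) ?_
      rw [Polynomial.coeff_C_mul, coeff_totalDegree_lineSubst, ← hc, ← C_mul, inv_mul_cancel₀ hv,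
        C_1]
    · have h1 : (lineSubst v F).eval₂ (projHom I (projAlong v Λ)) (projHom I Λ (X 0)) = 0 := by
        have := congrArg (Ideal.Quotient.mk I) (eval₂_lineSubst v Λ F)
        rw [Polynomial.hom_eval₂, Ideal.Quotient.eq_zero_iff_mem.2 hF] at this
        exact this
      rw [Polynomial.eval₂_mul, h1, mul_zero]
  refine isIntegral_of_isIntegralElem_X _ _ hΛ (fun a => ?_) fun i => ?_
  · change Ideal.Quotient.mk I (linSubst _ _) = Ideal.Quotient.mk I (linSubst _ _)
    rw [linSubst_C, linSubst_C]
  · refine Fin.cases hz (fun i => ?_) i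
    have h : projHom I Λ (X i.succ) = projHom I (projAlong v Λ) (X i) +
        projHom I (projAlong v Λ) (C (v i)) * projHom I Λ (X 0) := by
      change Ideal.Quotient.mk I (linSubst _ _) = Ideal.Quotient.mk I (linSubst _ _) +
        Ideal.Quotient.mk I (linSubst _ _) * Ideal.Quotient.mk I (linSubst _ _)
      rw [linSubst_projAlong_X, linSubst_C, ← map_mul, ← map_add, sub_add_cancel]
    rw [h]
    exact RingHom.IsIntegralElem.add _ (RingHom.isIntegralElem_map _)
      (RingHom.IsIntegralElem.mul _ (RingHom.isIntegralElem_map _) hz)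

theorem homogeneousComponent_totalDegree_ne_zero {σ : Type*} {F : MvPolynomial σ L} (hF : F ≠ 0) :
    homogeneousComponent F.totalDegree F ≠ 0 := by
  obtain ⟨s, hs, hd⟩ := Finset.exists_mem_eq_sup F.support (support_nonempty.2 hF)
    fun s => s.sum fun _ e => e
  intro h
  have := coeff_homogeneousComponent F.totalDegree F s
  rw [h, coeff_zero, if_pos] at this
  · exact mem_support_iff.1 hs this.symm
  · exact hd.symm

theorem exists_eval_ne_zero {σ : Type*} [Infinite L] {Q : MvPolynomial σ L} (hQ : Q ≠ 0) :
    ∃ x, eval x Q ≠ 0 := by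
  by_contra! h
  exact hQ (MvPolynomial.funext fun x => by rw [h, map_zero])

/-- A polynomial in the entries of a matrix gives a polynomial in `v` by evaluation at
`projAlong v Λ`. -/
theorem exists_eval_eq_eval_projAlong (Λ : Matrix (Fin (m + 1)) (Fin n) L)
    {τ : Type*} (b : τ → L) (Q : MvPolynomial ((Fin m × Fin n) ⊕ τ) L) :
    ∃ T : MvPolynomial (Fin m) L, ∀ v, eval v T =
      eval (Sum.elim (fun ij => projAlong v Λ ij.1 ij.2) b) Q := by
  refine ⟨aeval (Sum.elim (fun ij => C (Λ ij.1.succ ij.2) - X ij.1 * C (Λ 0 ij.2))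
    fun t => C (b t)) Q, fun v => ?_⟩
  rw [← aeval_eq_eval, ← aeval_eq_eval]
  change ((aeval v).comp (aeval _)) Q = _
  congr 1
  ext1 i
  rcases i with i | i <;> simp [projAlong]

theorem exists_isIntegral_projHom_of_le [Infinite L] (hnm : n ≤ m)
    {Q : MvPolynomial (Fin m × Fin n) L} (hQ : Q ≠ 0) :
    ∃ Λ : Matrix (Fin m) (Fin n) L, eval (fun ij => Λ ij.1 ij.2) Q ≠ 0 ∧
      (projHom I Λ).IsIntegral := by
  -- Where the determinant of the first `n` rows is nonzero, `Λ` has a left inverse and `projHom I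
  -- Λ` is surjective.
  let M : Matrix (Fin n) (Fin n) (MvPolynomial (Fin m × Fin n) L) :=
    Matrix.of fun i j => X (Fin.castLE hnm i, j)
  have heval : ∀ Λ : Matrix (Fin m) (Fin n) L, eval (fun ij => Λ ij.1 ij.2) M.det =
      (Λ.submatrix (Fin.castLE hnm) id).det := by
    intro Λ
    rw [RingHom.map_det]
    congr 1
    ext i j
    simp [M]
  have hdet : M.det ≠ 0 := by
    intro h0
    have h := heval (Matrix.of fun i j => if (i : ℕ) = j then 1 else 0)
    have h1 : (Matrix.of fun (i : Fin m) (j : Fin n) => if (i : ℕ) = j then (1 : L) else 0).submatrix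
        (Fin.castLE hnm) id = 1 := by
      ext i j
      simp [Matrix.one_apply, Fin.ext_iff]
    rw [h1, h0, Matrix.det_one, map_zero] at h
    exact zero_ne_one h
  obtain ⟨x, hx⟩ := exists_eval_ne_zero (mul_ne_zero hQ hdet)
  refine ⟨Matrix.of fun i j => x (i, j), ?_, ?_⟩
  · rw [map_mul] at hx
    exact left_ne_zero_of_mul hx
  · have h2 := heval (Matrix.of fun i j => x (i, j))
    rw [map_mul] at hx
    have h3 : IsUnit ((Matrix.of fun i j => x (i, j)).submatrix (Fin.castLE hnm) id).det := by
      rw [← h2]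
      exact isUnit_iff_ne_zero.2 (right_ne_zero_of_mul hx)
    set N := (Matrix.of fun i j => x (i, j)).submatrix (Fin.castLE hnm) id with hN
    refine isIntegral_projHom_of_leftInverse
      (Λ' := N⁻¹ * (1 : Matrix (Fin m) (Fin m) L).submatrix (Fin.castLE hnm) id) ?_
    rw [Matrix.mul_assoc]
    have h4 : (1 : Matrix (Fin m) (Fin m) L).submatrix (Fin.castLE hnm) id *
        (Matrix.of fun i j => x (i, j)) = N := by
      ext i j
      simp [Matrix.mul_apply, hN, Matrix.one_apply]
    rw [h4, Matrix.nonsing_inv_mul _ h3]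

/-- Linear Noether normalizations are Zariski dense. -/
theorem exists_isIntegral_projHom [Infinite L] {d : ℕ}
    (hd : ringKrullDim (MvPolynomial (Fin n) L ⧸ I) = d) (hdm : d ≤ m)
    {Q : MvPolynomial (Fin m × Fin n) L} (hQ : Q ≠ 0) :
    ∃ Λ : Matrix (Fin m) (Fin n) L, eval (fun ij => Λ ij.1 ij.2) Q ≠ 0 ∧
      (projHom I Λ).IsIntegral := by
  -- The induction lowers the target dimension from at least `n` one step at a time, as long as it
  -- exceeds `d`.
  obtain ⟨k, hk⟩ : ∃ k, n ≤ m + k := ⟨n, Nat.le_add_left n m⟩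
  induction k generalizing m with
  | zero => exact exists_isIntegral_projHom_of_le hk hQ
  | succ k ih =>
    have hinj : Function.Injective (Prod.map Fin.succ id : Fin m × Fin n → Fin (m + 1) × Fin n) :=
      (Fin.succ_injective m).prodMap Function.injective_id
    obtain ⟨Λ, hΛQ, hΛ⟩ := ih (m := m + 1) (by omega)
      (Q := rename (Prod.map Fin.succ id) Q)
      (by rwa [Ne, map_eq_zero_iff _ (rename_injective _ hinj)]) (by omega)
    obtain ⟨F, hF0, hF⟩ := exists_ne_zero_linSubst_mem hΛ hd (by omega)
    have hH0 : homogeneousComponent F.totalDegree F ≠ 0 := homogeneousComponent_totalDegree_ne_zero hF0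
    obtain ⟨T, hT0, hT⟩ := exists_ne_zero_eval_eq_eval_cons
      (homogeneousComponent_isHomogeneous F.totalDegree F) hH0
    obtain ⟨T', hT'⟩ := exists_eval_eq_eval_projAlong Λ (Fin.elim0 : Fin 0 → L)
      (rename Sum.inl Q)
    have hT'' : ∀ v, eval v T' = eval (fun ij => projAlong v Λ ij.1 ij.2) Q := fun v => by
      rw [hT', eval_rename, Sum.elim_comp_inl]
    have hT'0 : T' ≠ 0 := by
      rintro rfl
      -- At `v = 0` the projection deletes the first row, and `Q` was imposed on exactly the other
      -- rows.
      refine hΛQ ?_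
      have := hT'' 0
      rw [map_zero] at this
      rw [eval_rename, this]
      congr 2
      ext ij
      simp [projAlong]
    obtain ⟨v, hv⟩ := exists_eval_ne_zero (mul_ne_zero hT0 hT'0)
    rw [map_mul, hT, hT''] at hv
    exact ⟨projAlong v Λ, right_ne_zero_of_mul hv,
      isIntegral_projHom_projAlong hΛ hF (left_ne_zero_of_mul hv)⟩

end Normalization

/-! ### Relations of bounded degree between linear forms. -/

section DegreeBound

/-- `δ` is the resultant of `G` and its derivative. It is nonzero because `G` stays irreducible over
the fraction field by Gauss's lemma, and it is a combination of the two, so separability survives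
wherever `δ` does. -/
theorem exists_ne_zero_forall_separable_map {A : Type*} [CommRing A] [IsDomain A]
    [UniqueFactorizationMonoid A] {G : Polynomial A} (hG : Irreducible G)
    (hG' : Polynomial.derivative G ≠ 0) :
    ∃ δ : A, δ ≠ 0 ∧ ∀ {L : Type*} [Field L] (φ : A →+* L), φ δ ≠ 0 → (G.map φ).Separable := by
  have hdeg : G.natDegree ≠ 0 := fun h => hG' (by
    rw [Polynomial.eq_C_of_natDegree_eq_zero h, Polynomial.derivative_C])
  refine ⟨G.resultant (Polynomial.derivative G), ?_, fun φ hφ => ?_⟩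
  · let K := FractionRing A
    have hinj : Function.Injective (algebraMap A K) := IsFractionRing.injective A K
    have hirr : Irreducible (G.map (algebraMap A K)) :=
      ((hG.isPrimitive hdeg).irreducible_iff_irreducible_map_fraction_map).1 hG
    have hsep : (G.map (algebraMap A K)).Separable := by
      rw [Polynomial.separable_iff_derivative_ne_zero hirr, Polynomial.derivative_map]
      rwa [Ne, Polynomial.map_eq_zero_iff hinj]
    have h := Polynomial.resultant_ne_zero _ _ hsep
    rw [Polynomial.derivative_map, Polynomial.natDegree_map_eq_of_injective hinj,
      Polynomial.natDegree_map_eq_of_injective hinj, Polynomial.resultant_map_map] at h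
    exact fun h0 => h (by rw [h0, map_zero])
  · obtain ⟨p, q, -, -, h⟩ := Polynomial.exists_mul_add_mul_eq_C_resultant G
      (Polynomial.derivative G) le_rfl le_rfl (Or.inl hdeg)
    have h1 := congrArg (Polynomial.map φ) h
    rw [Polynomial.map_add, Polynomial.map_mul, Polynomial.map_mul, Polynomial.map_C,
      ← Polynomial.derivative_map] at h1
    refine ⟨Polynomial.C (φ (G.resultant (Polynomial.derivative G)))⁻¹ * p.map φ,
      Polynomial.C (φ (G.resultant (Polynomial.derivative G)))⁻¹ * q.map φ, ?_⟩
    have h2 : Polynomial.C (φ (G.resultant (Polynomial.derivative G)))⁻¹ *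
        Polynomial.C (φ (G.resultant (Polynomial.derivative G))) = 1 := by
      rw [← Polynomial.C_mul, inv_mul_cancel₀ hφ, Polynomial.C_1]
    rw [← h2, ← h1]
    ring

variable {L : Type*} [Field L] {m n : ℕ}

/-- The derivative along the lines is the directional derivative in direction `(1, v)`. At a point
where some partial derivative is nonzero, its value is a nonzero affine function of `v`. -/
theorem exists_ne_zero_lineSubst_derivative_ne_zero [IsAlgClosed L]
    {F : MvPolynomial (Fin (m + 1)) L} (hF : Irreducible F) :
    ∃ T : MvPolynomial (Fin m) L, T ≠ 0 ∧
      ∀ v, eval v T ≠ 0 → Polynomial.derivative (lineSubst v F) ≠ 0 := by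
  obtain ⟨i, hi⟩ := exists_pderiv_ne_zero_of_irreducible hF
  obtain ⟨p, hp⟩ := exists_eval_ne_zero hi
  have heval : ∀ v, eval v (C (eval p (pderiv 0 F)) +
      ∑ i : Fin m, C (eval p (pderiv i.succ F)) * X i) =
      eval p (pderiv 0 F + ∑ i : Fin m, C (v i) * pderiv i.succ F) := fun v => by
    simp [mul_comm]
  refine ⟨C (eval p (pderiv 0 F)) + ∑ i : Fin m, C (eval p (pderiv i.succ F)) * X i,
    fun h0 => hp ?_, fun v hv h => ?_⟩
  · have h1 : eval p (pderiv 0 F) = 0 := by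
      have := heval 0
      rw [h0] at this
      simpa using this.symm
    refine Fin.cases h1 (fun j => ?_) i
    have := heval (Pi.single j 1)
    rw [h0] at this
    simpa [h1, Pi.single_apply] using this.symm
  · rw [heval] at hv
    refine hv ?_
    rw [derivative_lineSubst] at h
    have h2 := eval_lineSubst v (fun i => p i.succ - v i * p 0) (p 0)
      (pderiv 0 F + ∑ i : Fin m, C (v i) * pderiv i.succ F)
    rw [h] at h2
    have h3 : (Fin.cons (p 0) (fun i => p i.succ - v i * p 0 + v i * p 0) : Fin (m + 1) → L) = p := by
      ext i
      refine Fin.cases ?_ (fun i => ?_) i <;> simp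
    rw [h3] at h2
    simpa using h2.symm

theorem card_roots_toFinset_of_separable [IsAlgClosed L] {g : Polynomial L}
    [DecidableEq L] (hg : g.Separable) : g.roots.toFinset.card = g.natDegree := by
  rw [Multiset.toFinset_card_of_nodup (Polynomial.nodup_roots hg),
    IsAlgClosed.card_roots_eq_natDegree]

theorem exists_totalDegree_le_of_isIntegral [IsAlgClosed L] {I : Ideal (MvPolynomial (Fin n) L)}
    [I.IsPrime] {d N : ℕ} (hd : ringKrullDim (MvPolynomial (Fin n) L ⧸ I) = d)
    {P : MvPolynomial ((Fin d × Fin n) ⊕ Fin d) L}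
    (hP : ∀ (M : Matrix (Fin d) (Fin n) L) (b : Fin d → L),
      eval (Sum.elim (fun ij => M ij.1 ij.2) b) P ≠ 0 →
        {y | y ∈ zeroLocus L I ∧ M.mulVec y = b}.encard = (N : ℕ∞))
    {Λ : Matrix (Fin (d + 1)) (Fin n) L} (hΛ : (projHom I Λ).IsIntegral) {b₀ : Fin d → L}
    (hb₀ : eval (Sum.elim (fun ij => Λ ij.1.succ ij.2) b₀) P ≠ 0) :
    ∃ F, F ≠ 0 ∧ F.totalDegree ≤ N ∧ linSubst Λ F ∈ I := by
  classical
  obtain ⟨F₀, hF₀, hF₀I⟩ := exists_ne_zero_linSubst_mem hΛ hd (Nat.lt_succ_self d)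
  obtain ⟨F, hF, -, hFI⟩ := exists_irreducible_dvd_linSubst_mem hF₀ hF₀I
  refine ⟨F, hF.ne_zero, ?_, hFI⟩
  obtain ⟨T₁, hT₁, hT₁v⟩ := exists_ne_zero_eval_eq_eval_cons
    (homogeneousComponent_isHomogeneous F.totalDegree F)
    (homogeneousComponent_totalDegree_ne_zero hF.ne_zero)
  obtain ⟨T₂, hT₂, hT₂v⟩ := exists_ne_zero_lineSubst_derivative_ne_zero hF
  obtain ⟨T₃, hT₃v⟩ := exists_eval_eq_eval_projAlong Λ b₀ P
  have hT₃ : T₃ ≠ 0 := by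
    rintro rfl
    have := hT₃v 0
    rw [map_zero] at this
    refine hb₀ ?_
    rw [this]
    congr 2
    ext ij
    simp [projAlong]
  -- A direction `v` for which lines see the full degree of `F`, `F` is not inseparable along them,
  -- and the planes `projAlong v Λ y = b` are generic for at least one `b`, namely `b₀`.
  obtain ⟨v, hv⟩ := exists_eval_ne_zero (mul_ne_zero (mul_ne_zero hT₁ hT₂) hT₃)
  rw [map_mul, map_mul, hT₁v, hT₃v] at hv
  have hv₁ := left_ne_zero_of_mul (left_ne_zero_of_mul hv)
  have hv₂ := hT₂v v (right_ne_zero_of_mul (left_ne_zero_of_mul hv))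
  have hv₃ := right_ne_zero_of_mul hv
  obtain ⟨δ, hδ, hδsep⟩ := exists_ne_zero_forall_separable_map (irreducible_lineSubst v hF) hv₂
  let T₄ : MvPolynomial (Fin d) L :=
    aeval (Sum.elim (fun ij => C (projAlong v Λ ij.1 ij.2)) X) P
  have hT₄v : ∀ b, eval b T₄ = eval (Sum.elim (fun ij => projAlong v Λ ij.1 ij.2) b) P := by
    intro b
    rw [← aeval_eq_eval, ← aeval_eq_eval]
    change ((aeval b).comp (aeval _)) P = _
    congr 1
    ext1 i
    rcases i with i | i <;> simp
  have hT₄ : T₄ ≠ 0 := fun h => hv₃ (by rw [← hT₄v, h, map_zero])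
  -- Now a line in that direction on which `F` has simple roots and whose preimage is a plane
  -- counted by the degree.
  obtain ⟨b, hb⟩ := exists_eval_ne_zero (mul_ne_zero hδ hT₄)
  rw [map_mul, hT₄v] at hb
  have hsep := hδsep (eval b) (left_ne_zero_of_mul hb)
  have hcoeff : ((lineSubst v F).map (eval b)).coeff F.totalDegree ≠ 0 := by
    rw [Polynomial.coeff_map, coeff_totalDegree_lineSubst, eval_C]
    exact hv₁
  set g := (lineSubst v F).map (eval b) with hg
  have hroot : ∀ t : L, g.IsRoot t → ∃ x ∈ zeroLocus L I,
      Λ.mulVec x = Fin.cons t (fun i => b i + v i * t) := fun t ht =>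
    exists_mem_zeroLocus_of_irreducible hΛ hd hF hFI (by rw [← eval_lineSubst]; exact ht)
  choose! x hxI hxΛ using hroot
  -- Roots on the line lift to distinct points of the plane section, of which there are `N`.
  have hmaps : Set.MapsTo x (g.roots.toFinset : Set L)
      {y | y ∈ zeroLocus L I ∧ (projAlong v Λ).mulVec y = b} := by
    intro t ht
    have ht' : g.IsRoot t := Polynomial.isRoot_of_mem_roots (by simpa using ht)
    refine ⟨hxI t ht', ?_⟩
    ext i
    rw [projAlong_mulVec, hxΛ t ht']
    simp
  have hinj : Set.InjOn x (g.roots.toFinset : Set L) := by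
    intro s hs t ht hst
    have hs' : g.IsRoot s := Polynomial.isRoot_of_mem_roots (by simpa using hs)
    have ht' : g.IsRoot t := Polynomial.isRoot_of_mem_roots (by simpa using ht)
    have := hxΛ s hs'
    rw [hst, hxΛ t ht'] at this
    simpa using (congrFun this 0).symm
  have hcard := Set.encard_le_encard_of_injOn hmaps hinj
  rw [hP _ b (right_ne_zero_of_mul hb), Set.encard_coe_eq_coe_finsetCard,
    card_roots_toFinset_of_separable hsep] at hcard
  exact (Polynomial.le_natDegree_of_ne_zero hcoeff).trans (by exact_mod_cast hcard)

/-- The vectors of values at the points of `V` span, since a functional killing them all would be a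
linear dependence. A basis can then be chosen among them. -/
theorem exists_det_ne_zero_of_linearIndependent {ι V : Type*} [Fintype ι] [DecidableEq ι]
    {φ : ι → V → L} (hφ : LinearIndependent L φ) :
    ∃ v : ι → V, (Matrix.of fun i j => φ i (v j)).det ≠ 0 := by
  have hspan : Submodule.span L (Set.range fun x i => φ i x) = (⊤ : Submodule L (ι → L)) := by
    by_contra hne
    obtain ⟨f, hf0, hf⟩ := Submodule.exists_le_ker_of_lt_top _ (lt_top_iff_ne_top.2 hne)
    refine hf0 ?_
    have hsum : ∑ i, f (Pi.single i 1) • φ i = 0 := by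
      ext x
      have h := hf (Submodule.subset_span ⟨x, rfl⟩)
      rw [LinearMap.mem_ker, LinearMap.pi_apply_eq_sum_univ f] at h
      have hs : ∀ i : ι, (fun j => if i = j then (1 : L) else 0) = Pi.single i 1 := fun i => by
        ext j
        rw [Pi.single_apply]
        exact if_congr eq_comm rfl rfl
      simp only [hs] at h
      simpa [mul_comm, Finset.sum_apply] using h
    have h0 := Fintype.linearIndependent_iff.1 hφ _ hsum
    refine LinearMap.pi_ext' fun i => LinearMap.ext_ring ?_
    simpa using h0 i
  obtain ⟨B, hB, hBspan, hBli⟩ := exists_linearIndependent L (Set.range fun x i => φ i x)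
  let bas : Module.Basis B L (ι → L) := Module.Basis.mk hBli (by
    rw [Subtype.range_coe, hBspan, hspan])
  let e : ι ≃ B := (Pi.basisFun L ι).indexEquiv bas
  choose v hv using fun i => hB (e i).2
  refine ⟨v, ?_⟩
  have hli : LinearIndependent L (Matrix.of fun i j => φ i (v j)).transpose.row := by
    have h : (Matrix.of fun i j => φ i (v j)).transpose.row = (Subtype.val : B → ι → L) ∘ e := by
      ext i j
      exact congrFun (hv i) j
    rw [h]
    exact hBli.comp e e.injective
  rw [Matrix.linearIndependent_rows_iff_isUnit, Matrix.isUnit_iff_isUnit_det,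
    Matrix.det_transpose] at hli
  exact hli.ne_zero

theorem eval_aeval_apply {σ τ : Type*} (x : τ → L) (f : σ → MvPolynomial τ L)
    (P : MvPolynomial σ L) : eval x (aeval f P) = eval (fun i => eval x (f i)) P := by
  rw [← aeval_eq_eval, ← aeval_eq_eval]
  change ((aeval x).comp (aeval f)) P = _
  congr 1
  ext1 i
  simp

theorem eq_zero_of_sum_monomial_eq_zero {σ : Type*} {K : Finset (σ →₀ ℕ)} {c : K → L}
    (hc : ∑ s, monomial s.1 (c s) = 0) : c = 0 := by
  classical
  ext s
  have := congrArg (coeff s.1) hc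
  rw [coeff_sum, Finset.sum_eq_single s] at this
  · simpa using this
  · intro t _ hts
    rw [coeff_monomial, if_neg fun h => hts (Subtype.ext h)]
  · simp

theorem eval_eq_sum_of_support_subset {σ : Type*} {K : Finset (σ →₀ ℕ)} {F : MvPolynomial σ L}
    (hF : F.support ⊆ K) (x : σ → L) :
    eval x F = ∑ s : K, coeff s.1 F * eval x (monomial s.1 1) := by
  rw [Finset.sum_coe_sort K fun s => coeff s F * eval x (monomial s 1)]
  conv_lhs => rw [F.as_sum, map_sum]
  rw [Finset.sum_subset hF]
  · refine Finset.sum_congr rfl fun s _ => ?_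
    simp [eval_monomial]
  · intro s _ hs
    rw [notMem_support_iff.1 hs, monomial_zero, map_zero]

/-- The matrices `Λ` such that the monomials with exponents in `K` are linearly independent on
`Λ V` form a Zariski open set. -/
theorem exists_ne_zero_forall_eval_ne_zero (V : Set (Fin n → L)) (K : Finset (Fin m →₀ ℕ))
    (Λ₀ : Matrix (Fin m) (Fin n) L)
    (h₀ : ∀ F, F.support ⊆ K → (∀ x ∈ V, eval (Λ₀.mulVec x) F = 0) → F = 0) :
    ∃ D : MvPolynomial (Fin m × Fin n) L, D ≠ 0 ∧ ∀ Λ : Matrix (Fin m) (Fin n) L,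
      eval (fun ij => Λ ij.1 ij.2) D ≠ 0 →
        ∀ F, F.support ⊆ K → (∀ x ∈ V, eval (Λ.mulVec x) F = 0) → F = 0 := by
  classical
  let φ : K → V → L := fun s x => eval (Λ₀.mulVec x.1) (monomial s.1 1)
  have hφ : LinearIndependent L φ := by
    rw [Fintype.linearIndependent_iff]
    intro c hc
    refine congrFun (eq_zero_of_sum_monomial_eq_zero (h₀ _ ?_ fun x hx => ?_))
    · refine (support_sum).trans (Finset.biUnion_subset.2 fun s _ => ?_)
      exact (support_monomial_subset).trans (Finset.singleton_subset_iff.2 s.2)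
    · rw [map_sum]
      have := congrFun hc ⟨x, hx⟩
      simpa [φ, eval_monomial] using this
  obtain ⟨v, hv⟩ := exists_det_ne_zero_of_linearIndependent hφ
  -- The minor at the points `v`, nonzero for `Λ₀`, as a polynomial in the entries of `Λ`.
  let D : MvPolynomial (Fin m × Fin n) L := (Matrix.of fun (s t : K) =>
    aeval (fun i => ∑ j, X (i, j) * C ((v t).1 j)) (monomial s.1 (1 : L))).det
  have hD : ∀ Λ : Matrix (Fin m) (Fin n) L, eval (fun ij => Λ ij.1 ij.2) D =
      (Matrix.of fun (s t : K) => eval (Λ.mulVec (v t).1) (monomial s.1 1)).det := by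
    intro Λ
    rw [RingHom.map_det]
    congr 1
    ext s t
    rw [RingHom.mapMatrix_apply, Matrix.map_apply, Matrix.of_apply, Matrix.of_apply,
      eval_aeval_apply]
    congr 2
    ext i
    simp [Matrix.mulVec, dotProduct]
  refine ⟨D, fun h => hv ?_, fun Λ hΛ F hFK hF => ?_⟩
  · have := hD Λ₀
    rw [h, map_zero] at this
    exact this.symm
  · rw [hD] at hΛ
    by_contra hF0
    refine hΛ (Matrix.exists_vecMul_eq_zero_iff.1 ⟨fun s => coeff s.1 F, fun h => hF0 ?_, ?_⟩)
    · ext s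
      rw [coeff_zero]
      by_cases hs : s ∈ K
      · exact congrFun h ⟨s, hs⟩
      · exact notMem_support_iff.1 fun h => hs (hFK h)
    · ext t
      rw [Pi.zero_apply, ← hF _ (v t).2, eval_eq_sum_of_support_subset hFK]
      rfl

theorem linSubst_mem_iff [IsAlgClosed L] {I : Ideal (MvPolynomial (Fin n) L)} [hI : I.IsPrime]
    {Λ : Matrix (Fin m) (Fin n) L} {F : MvPolynomial (Fin m) L} :
    linSubst Λ F ∈ I ↔ ∀ x ∈ zeroLocus L I, eval (Λ.mulVec x) F = 0 := by
  conv_lhs => rw [← IsPrime.vanishingIdeal_zeroLocus (K := L) I, mem_vanishingIdeal_iff]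
  simp only [aeval_eq_eval]
  exact forall₂_congr fun x _ => by rw [← eval_linSubst]

/-- Any `d + 1` linear forms on an irreducible variety of dimension `d` and degree `N` satisfy
a polynomial equation of degree at most `N`. -/
theorem exists_totalDegree_le_linSubst_mem [IsAlgClosed L] {I : Ideal (MvPolynomial (Fin n) L)}
    [hI : I.IsPrime] {d N : ℕ} (hd : ringKrullDim (MvPolynomial (Fin n) L ⧸ I) = d)
    (hN : HasDegree (zeroLocus L I) d N) (Λ₀ : Matrix (Fin (d + 1)) (Fin n) L) :
    ∃ F, F ≠ 0 ∧ F.totalDegree ≤ N ∧ linSubst Λ₀ F ∈ I := by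
  classical
  obtain ⟨P, hP0, hP⟩ := hN
  by_contra! hcon
  have hfin : {s : Fin (d + 1) →₀ ℕ | s.degree ≤ N}.Finite := by
    refine (Set.finite_Iic (Finsupp.equivFunOnFinite.symm fun _ => N)).subset fun s hs i => ?_
    exact (Finsupp.le_degree i s).trans hs
  have hsupp : ∀ F : MvPolynomial (Fin (d + 1)) L, F.support ⊆ hfin.toFinset ↔
      F.totalDegree ≤ N := fun F => by
    rw [totalDegree, Finset.sup_le_iff]
    exact forall₂_congr fun s _ => by rw [Set.Finite.mem_toFinset]; rfl
  obtain ⟨D, hD0, hD⟩ := exists_ne_zero_forall_eval_ne_zero (zeroLocus L I) hfin.toFinset Λ₀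
    fun F hF hFI => by
      by_contra hF0
      exact hcon F hF0 ((hsupp F).1 hF) (linSubst_mem_iff.2 hFI)
  obtain ⟨z, hz⟩ := exists_eval_ne_zero hP0
  -- Genericity of the last `d` rows, with the right-hand side frozen at that of `z`.
  let P' : MvPolynomial (Fin (d + 1) × Fin n) L :=
    aeval (Sum.elim (fun ij => X (ij.1.succ, ij.2)) fun i => C (z (Sum.inr i))) P
  have hP' : ∀ Λ : Matrix (Fin (d + 1)) (Fin n) L, eval (fun ij => Λ ij.1 ij.2) P' =
      eval (Sum.elim (fun ij => Λ ij.1.succ ij.2) fun i => z (Sum.inr i)) P := by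
    intro Λ
    rw [eval_aeval_apply]
    congr 2
    ext i
    rcases i with i | i <;> simp
  have hP'0 : P' ≠ 0 := by
    intro h
    have := hP' (Matrix.of (Fin.cons 0 fun i j => z (Sum.inl (i, j))))
    rw [h, map_zero] at this
    refine hz ?_
    rw [this]
    congr 2
    ext i
    rcases i with i | i <;> simp
  obtain ⟨Λ, hΛ, hΛint⟩ := exists_isIntegral_projHom (m := d + 1) hd (Nat.le_succ d)
    (mul_ne_zero hD0 hP'0)
  rw [map_mul, hP'] at hΛ
  obtain ⟨F, hF0, hFN, hF⟩ := exists_totalDegree_le_of_isIntegral hd hP hΛint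
    (right_ne_zero_of_mul hΛ)
  -- Without a relation for `Λ₀` there would be none for generic `Λ`, but a generic finite
  -- projection has one.
  exact hF0 (hD Λ (left_ne_zero_of_mul hΛ) F ((hsupp F).2 hFN) (linSubst_mem_iff.1 hF))

end DegreeBound

/-! ### Equations of bounded degree and points that determine linear forms. -/

section Equations

variable {L : Type*} [Field L] {m n : ℕ} {I : Ideal (MvPolynomial (Fin n) L)}

theorem cons_mulVec (z : Fin n → L) (Λ : Matrix (Fin m) (Fin n) L) (x : Fin n → L) :
    Matrix.mulVec (Matrix.of (Fin.cons z Λ) : Matrix (Fin (m + 1)) (Fin n) L) x =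
      Fin.cons (∑ j, z j * x j) (Λ.mulVec x) := by
  ext i
  refine Fin.cases ?_ (fun i => ?_) i
  · simp [Matrix.mulVec, dotProduct]
    rfl
  · simp [Matrix.mulVec, dotProduct]
    rfl

theorem linSubst_cons_rename_succ (z : Fin n → L) (Λ : Matrix (Fin m) (Fin n) L)
    (F : MvPolynomial (Fin m) L) :
    linSubst (Matrix.of (Fin.cons z Λ) : Matrix (Fin (m + 1)) (Fin n) L) (rename Fin.succ F) =
      linSubst Λ F := by
  rw [linSubst, aeval_rename, linSubst]
  rfl

theorem isIntegral_projHom_cons {Λ : Matrix (Fin m) (Fin n) L} (hΛ : (projHom I Λ).IsIntegral)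
    (z : Fin n → L) :
    (projHom I (Matrix.of (Fin.cons z Λ) : Matrix (Fin (m + 1)) (Fin n) L)).IsIntegral := by
  have h : (projHom I (Matrix.of (Fin.cons z Λ) : Matrix (Fin (m + 1)) (Fin n) L)).comp
      (rename Fin.succ : MvPolynomial (Fin m) L →ₐ[L] _).toRingHom = projHom I Λ :=
    RingHom.ext fun F => congrArg (Ideal.Quotient.mk I) (linSubst_cons_rename_succ z Λ F)
  rw [← h] at hΛ
  exact RingHom.IsIntegral.tower_top _ _ hΛ

theorem finite_fiber_of_isIntegral {Λ : Matrix (Fin m) (Fin n) L}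
    (hΛ : (projHom I Λ).IsIntegral) (b : Fin m → L) :
    {x | x ∈ zeroLocus L I ∧ Λ.mulVec x = b}.Finite := by
  classical
  choose p hpm hp using fun j => hΛ (Ideal.Quotient.mk I (X j))
  refine (Set.Finite.pi fun j => ((p j).map (eval b)).roots.toFinset.finite_toSet).subset ?_
  rintro x ⟨hxI, rfl⟩ j -
  have hm : ((p j).map (eval (Λ.mulVec x))).Monic := (hpm j).map _
  simp only [Finset.mem_coe, Multiset.mem_toFinset, Polynomial.mem_roots hm.ne_zero,
    Polynomial.IsRoot.def]
  have h1 : (p j).eval₂ (linSubst Λ).toRingHom (X j) ∈ I := by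
    rw [← Ideal.Quotient.eq_zero_iff_mem, Polynomial.hom_eval₂]
    exact hp j
  have h2 : eval x ((p j).eval₂ (linSubst Λ).toRingHom (X j)) = 0 := by
    rw [← aeval_eq_eval]
    exact hxI _ h1
  rw [Polynomial.hom_eval₂, eval_X] at h2
  rw [Polynomial.eval_map, ← h2]
  congr 1
  exact RingHom.ext fun F => (eval_linSubst Λ x F).symm

/-- Choose `z` off the finitely many hyperplanes orthogonal to the nonzero vectors `x - q`. -/
theorem exists_forall_sum_mul_ne [Infinite L] {S : Set (Fin n → L)} (hS : S.Finite)
    {q : Fin n → L} (hq : q ∉ S) :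
    ∃ z : Fin n → L, ∀ x ∈ S, ∑ j, z j * x j ≠ ∑ j, z j * q j := by
  classical
  let Q : MvPolynomial (Fin n) L := ∏ x ∈ hS.toFinset, ∑ j, C (x j - q j) * X j
  have hQ : Q ≠ 0 := by
    refine Finset.prod_ne_zero_iff.2 fun x hx h => hq ?_
    have hxq : x = q := by
      ext j
      have := congrArg (eval (Pi.single j 1)) h
      simpa [Pi.single_apply, sub_eq_zero] using this
    rw [← hxq]
    simpa using hx
  obtain ⟨z, hz⟩ := exists_eval_ne_zero hQ
  refine ⟨z, fun x hx h => ?_⟩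
  rw [eval_prod] at hz
  refine Finset.prod_ne_zero_iff.1 hz x (by simpa using hx) ?_
  have : ∑ j, (x j - q j) * z j = ∑ j, z j * x j - ∑ j, z j * q j := by
    rw [← Finset.sum_sub_distrib]
    exact Finset.sum_congr rfl fun j _ => by ring
  simpa [h] using this

variable (L n) in
/-- The space of polynomial functions of degree at most `1` on affine `n`-space. -/
def affineFunctions : Submodule L ((Fin n → L) → L) :=
  Submodule.span L (insert 1 (Set.range fun j x => x j))

theorem one_mem_affineFunctions : (1 : (Fin n → L) → L) ∈ affineFunctions L n :=
  Submodule.subset_span (Set.mem_insert _ _)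

theorem linear_mem_affineFunctions (z : Fin n → L) :
    (fun x => ∑ j, z j * x j) ∈ affineFunctions L n := by
  have h : (fun x : Fin n → L => ∑ j, z j * x j) = ∑ j, z j • fun x : Fin n → L => x j := by
    ext x
    simp
  rw [h]
  exact sum_mem fun j _ => Submodule.smul_mem _ _
    (Submodule.subset_span (Set.mem_insert_of_mem _ ⟨j, rfl⟩))

theorem aeval_mem_pow {A σ : Type*} [CommRing A] [Algebra L A] {M : Submodule L A}
    (hM : (1 : A) ∈ M) {h : σ → A} (hh : ∀ i, h i ∈ M) {F : MvPolynomial σ L} {D : ℕ}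
    (hF : F.totalDegree ≤ D) : aeval h F ∈ M ^ D := by
  have hmon : ∀ s : σ →₀ ℕ, aeval h (monomial s (1 : L)) ∈ M ^ s.degree := by
    intro s
    induction s using Finsupp.induction_linear with
    | zero =>
      simp only [map_zero, pow_zero, monomial_zero', map_one]
      exact Submodule.one_le.1 le_rfl
    | add s t hs ht =>
      rw [← one_mul (1 : L), ← monomial_mul, map_mul, map_add, pow_add]
      exact Submodule.mul_mem_mul hs ht
    | single i a =>
      rw [← X_pow_eq_monomial, map_pow, aeval_X, Finsupp.degree_single]
      exact Submodule.pow_mem_pow M (hh i) a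
  rw [F.as_sum, map_sum]
  refine sum_mem fun s hs => ?_
  rw [← mul_one (coeff s F), ← smul_eq_mul, ← smul_monomial, map_smul]
  refine Submodule.smul_mem _ _ (pow_le_pow_right' (Submodule.one_le.2 hM) ?_ (hmon s))
  exact (le_totalDegree hs).trans hF

theorem totalDegree_le_of_dvd_of_ne_zero {σ : Type*} {F G : MvPolynomial σ L} (h : F ∣ G)
    (hG : G ≠ 0) : F.totalDegree ≤ G.totalDegree := by
  obtain ⟨H, rfl⟩ := h
  rw [totalDegree_mul_of_isDomain (left_ne_zero_of_mul hG) (right_ne_zero_of_mul hG)]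
  exact Nat.le_add_right _ _

/-- An irreducible variety of degree `N` is cut out by equations of degree at most `N`. -/
theorem exists_totalDegree_le_mem_eval_ne_zero [IsAlgClosed L] [hI : I.IsPrime] {d N : ℕ}
    (hd : ringKrullDim (MvPolynomial (Fin n) L ⧸ I) = d)
    (hN : HasDegree (zeroLocus L I) d N) {q : Fin n → L} (hq : q ∉ zeroLocus L I) :
    ∃ f ∈ affineFunctions L n ^ N, (∀ x ∈ zeroLocus L I, f x = 0) ∧ f q ≠ 0 := by
  obtain ⟨Λ, -, hΛ⟩ := exists_isIntegral_projHom (m := d) hd le_rfl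
    (Q := (1 : MvPolynomial (Fin d × Fin n) L)) one_ne_zero
  -- The extra form `z` separates `q` from the points of the variety in its fibre, so the image of
  -- `q` stays off the image hypersurface.
  obtain ⟨z, hz⟩ := exists_forall_sum_mul_ne (finite_fiber_of_isIntegral hΛ (Λ.mulVec q))
    (q := q) fun h => hq h.1
  have hΛ' := isIntegral_projHom_cons hΛ z
  set Λ' : Matrix (Fin (d + 1)) (Fin n) L := Matrix.of (Fin.cons z Λ) with hΛ'def
  obtain ⟨F, hF0, hFN, hF⟩ := exists_totalDegree_le_linSubst_mem hd hN Λ'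
  obtain ⟨F', hF'irr, hF'F, hF'⟩ := exists_irreducible_dvd_linSubst_mem hF0 hF
  refine ⟨fun x => eval (Λ'.mulVec x) F', ?_, linSubst_mem_iff.1 hF', fun h => ?_⟩
  · have h := aeval_mem_pow (one_mem_affineFunctions (L := L) (n := n))
      (fun i => linear_mem_affineFunctions (Λ' i))
      ((totalDegree_le_of_dvd_of_ne_zero hF'F hF0).trans hFN)
    convert h using 1
    ext x
    rw [← aeval_eq_eval]
    change _ = ((Pi.evalAlgHom L (fun _ : Fin n → L => L) x).comp (aeval _)) F'
    congr 1
    ext1 i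
    simp [Matrix.mulVec, dotProduct]
  obtain ⟨x, hxI, hx⟩ := exists_mem_zeroLocus_of_irreducible hΛ' hd hF'irr hF' h
  rw [hΛ'def, cons_mulVec, cons_mulVec, Fin.cons_inj] at hx
  exact hz x ⟨hxI, hx.2⟩ hx.1

/-- On an irreducible variety of dimension `d` and degree `N`, linear forms are determined by
their values at `(N + 1) ^ d` points. -/
theorem exists_finset_linear_eq_zero [IsAlgClosed L] [hI : I.IsPrime] {d N : ℕ}
    (hd : ringKrullDim (MvPolynomial (Fin n) L ⧸ I) = d)
    (hN : HasDegree (zeroLocus L I) d N) :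
    ∃ T : Finset (Fin n → L), ↑T ⊆ zeroLocus L I ∧ T.card ≤ (N + 1) ^ d ∧
      ∀ z : Fin n → L, (∀ x ∈ T, ∑ j, z j * x j = 0) → ∀ x ∈ zeroLocus L I, ∑ j, z j * x j = 0 := by
  classical
  obtain ⟨Λ, -, hΛ⟩ := exists_isIntegral_projHom (m := d) hd le_rfl
    (Q := (1 : MvPolynomial (Fin d × Fin n) L)) one_ne_zero
  -- The projection to `d`-space is onto; `x` picks a point above each grid point.
  choose x hxI hx using exists_mem_zeroLocus_of_dim_eq hΛ hd
  obtain ⟨S, hS⟩ := Infinite.exists_subset_card_eq L (N + 1)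
  refine ⟨(Fintype.piFinset fun _ : Fin d => S).image x, ?_, ?_, fun z hz => ?_⟩
  · intro y hy
    obtain ⟨p, -, rfl⟩ := Finset.mem_image.1 (Finset.mem_coe.1 hy)
    exact hxI p
  · refine Finset.card_image_le.trans ?_
    simp [hS]
  by_contra! hcon
  obtain ⟨x₁, hx₁I, hx₁⟩ := hcon
  set ℓ : MvPolynomial (Fin n) L := ∑ j, C (z j) * X j with hℓ
  have hℓeval : ∀ y, eval y ℓ = ∑ j, z j * y j := fun y => by simp [hℓ]
  have hℓI : ℓ ∉ I := fun h => hx₁ (by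
    rw [← hℓeval, ← aeval_eq_eval]
    exact hx₁I _ h)
  set Λ' : Matrix (Fin (d + 1)) (Fin n) L := Matrix.of (Fin.cons z Λ) with hΛ'def
  obtain ⟨F, hF0, hFN, hF⟩ := exists_totalDegree_le_linSubst_mem hd hN Λ'
  set G := finSuccEquiv L d F with hG
  have hG0 : G ≠ 0 := (map_ne_zero_iff _ (finSuccEquiv L d).injective).2 hF0
  -- Cancel powers of `ℓ`, which is nonzero modulo the prime `I`, so that the relation has a nonzero
  -- constant coefficient in `ℓ`.
  obtain ⟨H, hH⟩ : Polynomial.X ^ G.natTrailingDegree ∣ G :=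
    Polynomial.X_pow_dvd_iff.2 fun _ h => Polynomial.coeff_eq_zero_of_lt_natTrailingDegree h
  have hsubst : ∀ E : MvPolynomial (Fin (d + 1)) L, linSubst Λ' E =
      (finSuccEquiv L d E).eval₂ (linSubst Λ).toRingHom ℓ := by
    intro E
    induction E using MvPolynomial.induction_on with
    | C a => simp [finSuccEquiv_apply]
    | add p q hp hq => rw [map_add, map_add, Polynomial.eval₂_add, hp, hq]
    | mul_X p i hp =>
      rw [map_mul, map_mul, Polynomial.eval₂_mul, hp]
      congr 1
      refine Fin.cases ?_ (fun i => ?_) i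
      · simp [linSubst_X, finSuccEquiv_X_zero, hΛ'def, hℓ]
        rfl
      · simp [linSubst_X, finSuccEquiv_X_succ, hΛ'def]
        rfl
  have hHI : H.eval₂ (linSubst Λ).toRingHom ℓ ∈ I := by
    rw [hsubst, ← hG, hH, Polynomial.eval₂_mul, Polynomial.eval₂_X_pow] at hF
    exact (hI.mem_or_mem hF).resolve_left fun h => hℓI (hI.mem_of_pow_mem _ h)
  have hH0 : H.coeff 0 = G.coeff G.natTrailingDegree := by
    have h := congrArg (fun E => Polynomial.coeff E G.natTrailingDegree) hH
    simpa [Polynomial.coeff_X_pow_mul'] using h.symm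
  have hg0 : H.coeff 0 ≠ 0 := by
    rw [hH0]
    exact Polynomial.trailingCoeff_nonzero_iff_nonzero.2 hG0
  have hgN : (H.coeff 0).totalDegree ≤ N := by
    rw [hH0]
    rw [hH0] at hg0
    exact ((Nat.le_add_right _ _).trans (totalDegree_coeff_finSuccEquiv_add_le F _ hg0)).trans hFN
  -- As `ℓ` vanishes at the chosen points, this coefficient vanishes on the grid. Its degree in each
  -- variable is below `N + 1`, so it is zero.
  refine hg0 (eq_zero_of_eval_zero_at_prod_finset (H.coeff 0) (fun _ => S) (fun i => ?_) fun p hp => ?_)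
  · rw [hS]
    exact ((degreeOf_le_totalDegree _ _).trans hgN).trans_lt (Nat.lt_succ_self N)
  · have h1 : eval (x p) (H.eval₂ (linSubst Λ).toRingHom ℓ) = 0 := by
      rw [← aeval_eq_eval]
      exact hxI p _ hHI
    have h2 : eval (x p) ℓ = 0 := by
      rw [hℓeval]
      exact hz _ (Finset.mem_image_of_mem _ (Fintype.mem_piFinset.2 hp))
    rw [Polynomial.hom_eval₂, h2, Polynomial.eval₂_at_zero] at h1
    rw [← hx p, ← eval_linSubst]
    exact h1

end Equations

/-! ### Varieties and ideals: irreducibility, dimension, components. -/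

section Dictionary

variable {L : Type*} [Field L] {n : ℕ}

theorem isVariety_zeroLocus (I : Ideal (MvPolynomial (Fin n) L)) : IsVariety (zeroLocus L I) :=
  ⟨I, by simp only [← aeval_eq_eval]; rfl⟩

theorem zeroLocus_vanishingIdeal_of_isVariety {V : Set (Fin n → L)} (hV : IsVariety V) :
    zeroLocus L (vanishingIdeal L V) = V := by
  refine Set.Subset.antisymm ?_ (zeroLocus_vanishingIdeal_le V)
  obtain ⟨S, rfl⟩ := hV
  intro x hx p hp
  have := hx p fun y hy => by
    rw [aeval_eq_eval]
    exact hy p hp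
  rwa [aeval_eq_eval] at this

theorem IsIrreducibleVariety.isPrime_vanishingIdeal {V : Set (Fin n → L)}
    (hV : IsIrreducibleVariety V) : (vanishingIdeal L V).IsPrime := by
  obtain ⟨hvar, ⟨x, hx⟩, hirr⟩ := hV
  have hcut : ∀ f : MvPolynomial (Fin n) L, IsVariety (V ∩ {y | eval y f = 0}) := fun f => by
    obtain ⟨S, rfl⟩ := hvar
    refine ⟨insert f S, ?_⟩
    ext y
    simp [and_comm]
  have hmem : ∀ f : MvPolynomial (Fin n) L, V ∩ {y | eval y f = 0} = V → f ∈ vanishingIdeal L V :=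
    fun f hf y hy => by
      rw [aeval_eq_eval]
      rw [← hf] at hy
      exact hy.2
  refine ⟨fun h => ?_, fun {f g} hfg => ?_⟩
  · have h1 : (1 : MvPolynomial (Fin n) L) ∈ vanishingIdeal L V := h ▸ Submodule.mem_top
    simpa using h1 x hx
  · refine (hirr _ _ (hcut f) (hcut g) ?_).imp (hmem f) (hmem g)
    ext y
    simp only [Set.mem_union, Set.mem_inter_iff, Set.mem_ofPred_eq, ← and_or_left]
    refine ⟨fun hy => ⟨hy, ?_⟩, fun hy => hy.1⟩
    have := hfg y hy
    rwa [map_mul, mul_eq_zero, aeval_eq_eval] at this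

variable [IsAlgClosed L]

theorem isIrreducibleVariety_zeroLocus (I : Ideal (MvPolynomial (Fin n) L)) [hI : I.IsPrime] :
    IsIrreducibleVariety (zeroLocus L I) := by
  refine ⟨isVariety_zeroLocus I, ?_, fun V₁ V₂ h₁ h₂ h => ?_⟩
  · by_contra hne
    rw [Set.not_nonempty_iff_eq_empty] at hne
    have := IsPrime.vanishingIdeal_zeroLocus (K := L) I
    rw [hne, vanishingIdeal_empty] at this
    exact hI.ne_top this.symm
  · have hle : vanishingIdeal L V₁ * vanishingIdeal L V₂ ≤ I := by
      rw [← IsPrime.vanishingIdeal_zeroLocus (K := L) I, h]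
      refine Ideal.mul_le.2 fun f hf g hg x hx => ?_
      rw [map_mul]
      rcases hx with hx | hx
      · rw [hf x hx, zero_mul]
      · rw [hg x hx, mul_zero]
    have key : ∀ V : Set (Fin n → L), IsVariety V → V ⊆ zeroLocus L I → vanishingIdeal L V ≤ I →
        V = zeroLocus L I := fun V hV hVI hle' => hVI.antisymm (by
      rw [← zeroLocus_vanishingIdeal_of_isVariety hV]
      exact zeroLocus_anti_mono hle')
    exact (hI.mul_le.1 hle).imp (key V₁ h₁ (h ▸ Set.subset_union_left))
      (key V₂ h₂ (h ▸ Set.subset_union_right))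

variable (L n) in
/-- Irreducible varieties correspond to prime ideals. -/
noncomputable def irreducibleVarietyOrderIso :
    IrreducibleVariety L n ≃o (PrimeSpectrum (MvPolynomial (Fin n) L))ᵒᵈ where
  toFun V := OrderDual.toDual ⟨vanishingIdeal L V.1, V.2.isPrime_vanishingIdeal⟩
  invFun p := ⟨zeroLocus L (OrderDual.ofDual p).asIdeal,
    have := (OrderDual.ofDual p).isPrime
    isIrreducibleVariety_zeroLocus _⟩
  left_inv V := Subtype.ext (zeroLocus_vanishingIdeal_of_isVariety V.2.1)
  right_inv p := by
    have := (OrderDual.ofDual p).isPrime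
    exact congrArg OrderDual.toDual
      (PrimeSpectrum.ext (IsPrime.vanishingIdeal_zeroLocus (K := L) (OrderDual.ofDual p).asIdeal))
  map_rel_iff' {V V'} := by
    refine ⟨fun h => ?_, fun h => vanishingIdeal_anti_mono h⟩
    change V.1 ⊆ V'.1
    rw [← zeroLocus_vanishingIdeal_of_isVariety V.2.1,
      ← zeroLocus_vanishingIdeal_of_isVariety V'.2.1]
    exact zeroLocus_anti_mono h

theorem ringKrullDim_quotient_vanishingIdeal (V : IrreducibleVariety L n) :
    ringKrullDim (MvPolynomial (Fin n) L ⧸ vanishingIdeal L V.1) = (dim V : WithBot ℕ∞) := by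
  rw [ringKrullDim_quotient, dim, ← Order.height_orderIso (irreducibleVarietyOrderIso L n) V,
    ← Order.coheight_ofDual, Order.coheight_eq_krullDim_Ici]
  rfl

/-- A minimal prime over the ideal of `W`, inside the ideal of `x`, defines the component. -/
theorem exists_mem_components_mem {W : Set (Fin n → L)} (hW : IsVariety W) {x : Fin n → L}
    (hx : x ∈ W) : ∃ V ∈ components W, x ∈ V.1 := by
  obtain ⟨p, hp, hpx⟩ := Ideal.exists_minimalPrimes_le (I := vanishingIdeal L W)
    (J := vanishingIdeal L {x}) (vanishingIdeal_anti_mono (Set.singleton_subset_iff.2 hx))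
  have := hp.1.1
  refine ⟨⟨zeroLocus L p, isIrreducibleVariety_zeroLocus p⟩, ⟨?_, fun V hVW hV => ?_⟩, ?_⟩
  · change zeroLocus L p ⊆ W
    rw [← zeroLocus_vanishingIdeal_of_isVariety hW]
    exact zeroLocus_anti_mono hp.1.2
  · change V.1 ⊆ zeroLocus L p
    rw [← zeroLocus_vanishingIdeal_of_isVariety V.2.1]
    refine zeroLocus_anti_mono (hp.2 ⟨V.2.isPrime_vanishingIdeal, vanishingIdeal_anti_mono hVW⟩ ?_)
    rw [← IsPrime.vanishingIdeal_zeroLocus (K := L) p]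
    exact vanishingIdeal_anti_mono hV
  · change x ∈ zeroLocus L p
    exact fun f hf => hpx hf x rfl

end Dictionary

/-! ### Dimension of spaces of functions restricted to a variety. -/

section Restriction

variable {L : Type*} [Field L] {n : ℕ}

variable (L) in
/-- Restriction of functions to `V`. -/
def restrictFun (V : Set (Fin n → L)) : ((Fin n → L) → L) →ₐ[L] (V → L) :=
  AlgHom.pi fun x => Pi.evalAlgHom L (fun _ => L) x.1

@[simp]
theorem restrictFun_apply (V : Set (Fin n → L)) (f : (Fin n → L) → L) (x : V) :
    restrictFun L V f x = f x.1 := rfl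

theorem affineFunctions_fg : (affineFunctions L n).FG :=
  ⟨(insert 1 (Set.range fun j x => x j) : Set ((Fin n → L) → L)).toFinite.toFinset, by
    rw [Set.Finite.coe_toFinset]; rfl⟩

theorem finrank_pow_le {A : Type*} [CommRing A] [Algebra L A] (M : Submodule L A)
    [FiniteDimensional L M] (D : ℕ) :
    Module.finrank L (M ^ D : Submodule L A) ≤ Module.finrank L M ^ D := by
  classical
  obtain ⟨s, hs, hM⟩ : ∃ s : Finset A, s.card = Module.finrank L M ∧ Submodule.span L s = M := by
    let b := Module.finBasis L M
    refine ⟨Finset.univ.map ⟨fun i => (b i : A), fun i j h => b.injective (Subtype.ext h)⟩, by simp, ?_⟩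
    have h := congrArg (Submodule.map M.subtype) b.span_eq
    rw [Submodule.map_top, Submodule.range_subtype, Submodule.map_span, ← Set.range_comp] at h
    refine Eq.trans ?_ h
    congr 1
    ext
    simp
    rfl
  rw [← hs]
  conv_lhs => rw [← hM, Submodule.span_pow, ← Finset.coe_pow]
  exact (finrank_span_finset_le_card _).trans Finset.card_pow_le

theorem affineFunctions_eq_sup : affineFunctions L n =
    Submodule.span L {1} ⊔ Submodule.span L (Set.range fun j (x : Fin n → L) => x j) := by
  rw [affineFunctions, Set.insert_eq, Submodule.span_union]

/-- Evaluation on `T` embeds the linear forms on `V`; the constants add one dimension. The bound is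
free of `n`. -/
theorem finrank_map_restrictFun_affineFunctions_le {V : Set (Fin n → L)} {T : Finset (Fin n → L)}
    (hTV : ↑T ⊆ V) (hT : ∀ z : Fin n → L, (∀ x ∈ T, ∑ j, z j * x j = 0) →
      ∀ x ∈ V, ∑ j, z j * x j = 0) :
    Module.finrank L ((affineFunctions L n).map (restrictFun L V).toLinearMap) ≤ T.card + 1 := by
  rw [affineFunctions_eq_sup, Submodule.map_sup, add_comm]
  set M₀ := (Submodule.span L {(1 : (Fin n → L) → L)}).map (restrictFun L V).toLinearMap with hM₀
  set M := (Submodule.span L (Set.range fun j (x : Fin n → L) => x j)).map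
    (restrictFun L V).toLinearMap with hM
  have hfin₀ : FiniteDimensional L M₀ := Module.Finite.iff_fg.2
    ((Submodule.fg_span (Set.finite_singleton _)).map _)
  have hfin : FiniteDimensional L M := Module.Finite.iff_fg.2
    ((Submodule.fg_span (Set.finite_range _)).map _)
  refine (Submodule.finrank_add_le_finrank_add_finrank _ _).trans (add_le_add ?_ ?_)
  · rw [hM₀, Submodule.map_span, Set.image_singleton]
    simpa using finrank_span_le_card (R := L) {(restrictFun L V).toLinearMap 1}
  · let e : M →ₗ[L] (T → L) :=
      (LinearMap.funLeft L L fun t : T => (⟨t.1, hTV t.2⟩ : V)).comp M.subtype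
    have he : Function.Injective e := by
      rw [injective_iff_map_eq_zero]
      rintro ⟨f, g, hg, rfl⟩ hf
      obtain ⟨z, rfl⟩ := Submodule.mem_span_range_iff_exists_fun L |>.1 hg
      refine Subtype.ext (funext fun x => ?_)
      have := hT z (fun t ht => by
        simpa [e, LinearMap.funLeft] using congrFun hf ⟨t, ht⟩) x.1 x.2
      simpa using this
    simpa using LinearMap.finrank_le_finrank_of_injective he

theorem finiteDimensional_affineFunctions_pow (D : ℕ) :
    FiniteDimensional L (affineFunctions L n ^ D : Submodule L ((Fin n → L) → L)) :=
  Module.Finite.iff_fg.2 (affineFunctions_fg.pow D)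

/-- The space of polynomial functions of degree at most `D` on an irreducible variety has dimension
bounded in terms of the dimension and the degree of the variety. -/
theorem finrank_map_restrictFun_affineFunctions_pow_le [IsAlgClosed L]
    (V : IrreducibleVariety L n) {d N : ℕ} (hd : dim V = d) (hN : HasDegree V.1 d N) (D : ℕ) :
    Module.finrank L ((affineFunctions L n ^ D).map (restrictFun L V.1).toLinearMap) ≤
      ((N + 1) ^ d + 1) ^ D := by
  have hprime := V.2.isPrime_vanishingIdeal
  have hV := zeroLocus_vanishingIdeal_of_isVariety V.2.1
  have hdim : ringKrullDim (MvPolynomial (Fin n) L ⧸ vanishingIdeal L V.1) = d := by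
    rw [ringKrullDim_quotient_vanishingIdeal, hd]
    rfl
  obtain ⟨T, hTV, hTcard, hT⟩ := exists_finset_linear_eq_zero hdim (by rwa [hV])
  rw [hV] at hTV hT
  have hfin : FiniteDimensional L
      ((affineFunctions L n).map (restrictFun L V.1).toLinearMap) :=
    Module.Finite.iff_fg.2 (affineFunctions_fg.map _)
  rw [Submodule.map_pow]
  refine (finrank_pow_le _ D).trans (Nat.pow_le_pow_left ?_ D)
  exact (finrank_map_restrictFun_affineFunctions_le hTV hT).trans (by omega)

theorem exists_mem_affineFunctions_pow_ne_zero [IsAlgClosed L]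
    (V : IrreducibleVariety L n) {d N : ℕ} (hd : dim V = d) (hN : HasDegree V.1 d N)
    {q : Fin n → L} (hq : q ∉ V.1) :
    ∃ f ∈ affineFunctions L n ^ N, (∀ x ∈ V.1, f x = 0) ∧ f q ≠ 0 := by
  have hprime := V.2.isPrime_vanishingIdeal
  have hV := zeroLocus_vanishingIdeal_of_isVariety V.2.1
  have hdim : ringKrullDim (MvPolynomial (Fin n) L ⧸ vanishingIdeal L V.1) = d := by
    rw [ringKrullDim_quotient_vanishingIdeal, hd]
    rfl
  have := exists_totalDegree_le_mem_eval_ne_zero hdim (by rwa [hV]) (q := q) (by rwa [hV])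
  rwa [hV] at this

end Restriction

/-! ### Growth of sums of translates of a subspace. -/

section Escape

/-- While the sum of translates is not stable under `A`, one further translate enlarges it; the
codimension allows this at most `m` times. Once stable under the generators it is stable under `G`
and contains all translates of `I`. Composition reverses order, as for functions precomposed with
the action, so new elements are `s * a`. -/
theorem exists_finset_forall_map_le {L E G : Type*} [Field L] [AddCommGroup E] [Module L E]
    [Group G] {ρ : G → E →ₗ[L] E} (hρ : ∀ g h, ρ h ∘ₗ ρ g = ρ (g * h))
    (hρ₁ : ρ 1 = LinearMap.id) {P I : Submodule L E} [FiniteDimensional L P]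
    (hP : ∀ g, P.map (ρ g) ≤ P) (hIP : I ≤ P) {m : ℕ}
    (hm : Module.finrank L P ≤ Module.finrank L I + m) {A : Set G}
    (hA : Subgroup.closure A = ⊤) (hAinv : A⁻¹ = A) (hA₁ : 1 ∈ A) :
    ∃ S : Finset G, ↑S ⊆ A ^ m ∧ S.card ≤ m + 1 ∧
      ∀ g, I.map (ρ g) ≤ ⨆ s ∈ S, I.map (ρ s) := by
  classical
  let J : Finset G → Submodule L E := fun S => ⨆ s ∈ S, I.map (ρ s)
  have hJP : ∀ S, J S ≤ P := fun S => iSup₂_le fun s _ => (Submodule.map_mono hIP).trans (hP s)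
  have hmap : ∀ g h, (I.map (ρ g)).map (ρ h) = I.map (ρ (g * h)) := fun g h => by
    rw [← Submodule.map_comp, hρ]
  by_contra! hcon
  have hstep : ∀ j ≤ m + 1, ∃ S : Finset G, 1 ∈ S ∧ ↑S ⊆ A ^ j ∧ S.card ≤ j + 1 ∧
      Module.finrank L I + j ≤ Module.finrank L (J S) := by
    intro j
    induction j with
    | zero =>
      refine fun _ => ⟨{1}, by simp, by simp, by simp, ?_⟩
      have : J {1} = I := by simp [J, hρ₁]
      rw [this, add_zero]
    | succ j ih =>
      intro hj
      obtain ⟨S, hS₁, hSA, hScard, hSrank⟩ := ih (by omega)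
      obtain ⟨a, ha, haJ⟩ : ∃ a ∈ A, ¬ (J S).map (ρ a) ≤ J S := by
        by_contra! hinv
        have hall : ∀ g, (J S).map (ρ g) ≤ J S := fun g => by
          have hmem : g ∈ Subgroup.closure A := hA ▸ Subgroup.mem_top g
          induction hmem using Subgroup.closure_induction'' with
          | mem x hx => exact hinv x hx
          | inv_mem x hx => exact hinv _ (hAinv ▸ Set.inv_mem_inv.2 hx)
          | one => rw [hρ₁, Submodule.map_id]
          | mul x y _ _ hx hy =>
            rw [← hρ, Submodule.map_comp]
            exact (Submodule.map_mono hx).trans hy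
        obtain ⟨g, hg⟩ := hcon S (hSA.trans (Set.pow_subset_pow_right hA₁ (by omega))) (by omega)
        refine hg ((Submodule.map_mono ?_).trans (hall g))
        have h1 := le_iSup₂ (f := fun s (_ : s ∈ S) => I.map (ρ s)) 1 hS₁
        rwa [hρ₁, Submodule.map_id] at h1
      obtain ⟨s, hs, hsJ⟩ : ∃ s ∈ S, ¬ I.map (ρ (s * a)) ≤ J S := by
        by_contra! h
        refine haJ ?_
        simp only [J, Submodule.map_iSup, hmap]
        exact iSup₂_le h
      have hle : J S ≤ J (insert (s * a) S) := biSup_mono fun t ht => Finset.mem_insert_of_mem ht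
      have hlt : J S < J (insert (s * a) S) := by
        refine lt_of_le_of_ne hle fun h => hsJ ?_
        rw [h]
        exact le_iSup₂ (f := fun t (_ : t ∈ insert (s * a) S) => I.map (ρ t)) (s * a)
          (Finset.mem_insert_self _ _)
      refine ⟨insert (s * a) S, Finset.mem_insert_of_mem hS₁, ?_, ?_, ?_⟩
      · rw [Finset.coe_insert, Set.insert_subset_iff]
        refine ⟨?_, hSA.trans (Set.pow_subset_pow_right hA₁ (Nat.le_succ j))⟩
        rw [pow_succ]
        exact Set.mul_mem_mul (hSA hs) ha
      · exact (Finset.card_insert_le _ _).trans (by omega)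
      · have : FiniteDimensional L (J (insert (s * a) S)) :=
          Submodule.finiteDimensional_of_le (hJP _)
        have := Submodule.finrank_lt_finrank_of_lt hlt
        omega
  obtain ⟨S, -, -, -, hS⟩ := hstep (m + 1) le_rfl
  have := Submodule.finrank_mono (hJP S)
  omega

/-- Rank-nullity for the product of the maps. With restrictions to the components it bounds the
codimension of the functions vanishing on `W`. -/
theorem finrank_le_finrank_add_sum {L E ι : Type*} [Field L] [AddCommGroup E] [Module L E]
    [Fintype ι] {F : ι → Type*} [∀ i, AddCommGroup (F i)] [∀ i, Module L (F i)]
    (P : Submodule L E) [FiniteDimensional L P] (f : ∀ i, E →ₗ[L] F i) :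
    Module.finrank L P ≤ Module.finrank L (P ⊓ ⨅ i, LinearMap.ker (f i) : Submodule L E) +
      ∑ i, Module.finrank L (P.map (f i)) := by
  let Ψ : P →ₗ[L] ∀ i, P.map (f i) := LinearMap.pi fun i => (f i).submoduleMap P
  have hker : (LinearMap.ker Ψ).map P.subtype = P ⊓ ⨅ i, LinearMap.ker (f i) := by
    ext x
    simp only [Submodule.mem_map, LinearMap.mem_ker, Submodule.subtype_apply, Submodule.mem_inf,
      Submodule.mem_iInf]
    constructor
    · rintro ⟨y, hy, rfl⟩
      exact ⟨y.2, fun i => congrArg Subtype.val (congrFun hy i)⟩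
    · rintro ⟨hx, h⟩
      exact ⟨⟨x, hx⟩, funext fun i => Subtype.ext (h i), rfl⟩
  rw [← hker, Submodule.finrank_map_subtype_eq, ← Module.finrank_pi_fintype,
    ← LinearMap.finrank_range_add_finrank_ker Ψ, add_comm]
  exact Nat.add_le_add_left (Submodule.finrank_le _) _

theorem prod_mem_pow_sum {R A ι : Type*} [CommSemiring R] [CommSemiring A] [Algebra R A]
    {M : Submodule R A} {f : ι → A} {N : ι → ℕ} (s : Finset ι) (hf : ∀ i ∈ s, f i ∈ M ^ N i) :
    ∏ i ∈ s, f i ∈ M ^ ∑ i ∈ s, N i := by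
  classical
  induction s using Finset.induction_on with
  | empty => simpa using Submodule.one_le.1 (le_refl (1 : Submodule R A))
  | insert i s hi ih =>
    rw [Finset.prod_insert hi, Finset.sum_insert hi, pow_add]
    exact Submodule.mul_mem_mul (hf i (Finset.mem_insert_self _ _))
      (ih fun j hj => hf j (Finset.mem_insert_of_mem hj))

end Escape

/-! ### The group action on functions and uniform escape. -/

section Action

variable {K : Type*} [Field K] {G : Type*} [Group G] {n : ℕ} (φ : G →* GL (Fin n) K)

theorem act_one (x : Fin n → AlgebraicClosure K) : act φ 1 x = x := by
  simp [act]

theorem act_mul (g h : G) (x : Fin n → AlgebraicClosure K) :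
    act φ (g * h) x = act φ g (act φ h x) := by
  simp [act, Matrix.map_mul]

/-- The action on functions by composition. -/
noncomputable def actFun (g : G) : ((Fin n → AlgebraicClosure K) → AlgebraicClosure K) →ₐ[
    AlgebraicClosure K] ((Fin n → AlgebraicClosure K) → AlgebraicClosure K) :=
  AlgHom.pi fun x => Pi.evalAlgHom _ (fun _ => AlgebraicClosure K) (act φ g x)

@[simp]
theorem actFun_apply (g : G) (f : (Fin n → AlgebraicClosure K) → AlgebraicClosure K)
    (x : Fin n → AlgebraicClosure K) : actFun φ g f x = f (act φ g x) := rfl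

theorem map_actFun_affineFunctions_pow_le (g : G) (D : ℕ) :
    (affineFunctions (AlgebraicClosure K) n ^ D).map (actFun φ g).toLinearMap ≤
      affineFunctions (AlgebraicClosure K) n ^ D := by
  rw [Submodule.map_pow]
  refine pow_le_pow_left' ?_ D
  rw [affineFunctions, Submodule.map_span, Submodule.span_le, ← affineFunctions]
  rintro _ ⟨f, rfl | ⟨j, rfl⟩, rfl⟩
  · exact one_mem_affineFunctions
  · exact linear_mem_affineFunctions
      (fun i => algebraMap K (AlgebraicClosure K) ((φ g : Matrix (Fin n) (Fin n) K) j i))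

theorem mem_iff_of_hasComponentInvariants {L : Type*} [Field L] [IsAlgClosed L] {n r : ℕ}
    {W : Set (Fin n → L)} (hW : IsVariety W) {V : Fin r → IrreducibleVariety L n}
    (hV : Set.range V = components W) (x : Fin n → L) : x ∈ W ↔ ∃ i, x ∈ (V i).1 := by
  constructor
  · intro hx
    obtain ⟨U, hU, hxU⟩ := exists_mem_components_mem hW hx
    rw [← hV] at hU
    obtain ⟨i, rfl⟩ := hU
    exact ⟨i, hxU⟩
  · rintro ⟨i, hi⟩
    have h : V i ∈ components W := hV ▸ Set.mem_range_self i
    rw [components, Set.mem_ofPred_eq] at h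
    exact h.prop hi

theorem exists_finset_forall_act_notMem {r : ℕ} {d N : Fin r → ℕ}
    {W : Set (Fin n → AlgebraicClosure K)} (hW : IsVariety W)
    (hinv : HasComponentInvariants W r d N) {A : Set G} (hA : Subgroup.closure A = ⊤)
    (hAinv : A⁻¹ = A) (hA₁ : 1 ∈ A) :
    ∃ S : Finset G, ↑S ⊆ A ^ (∑ i, ((N i + 1) ^ d i + 1) ^ ∑ i, N i) ∧
      S.card ≤ (∑ i, ((N i + 1) ^ d i + 1) ^ ∑ i, N i) + 1 ∧
      ∀ y, (∃ g, act φ g y ∉ W) → ∃ s ∈ S, act φ s y ∉ W := by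
  obtain ⟨V, -, hVW, hV⟩ := hinv
  have hmem := mem_iff_of_hasComponentInvariants hW hVW
  set D := ∑ i, N i with hD
  let P := affineFunctions (AlgebraicClosure K) n ^ D
  let I : Submodule (AlgebraicClosure K) ((Fin n → AlgebraicClosure K) → AlgebraicClosure K) :=
    P ⊓ ⨅ i, LinearMap.ker (restrictFun (AlgebraicClosure K) (V i).1).toLinearMap
  have hI : ∀ f ∈ I, ∀ y ∈ W, f y = 0 := by
    intro f hf y hy
    obtain ⟨i, hi⟩ := (hmem y).1 hy
    exact congrFun ((Submodule.mem_iInf _).1 hf.2 i) ⟨y, hi⟩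
  have hsep : ∀ y ∉ W, ∃ f ∈ I, f y ≠ 0 := by
    intro y hy
    have hyV : ∀ i, y ∉ (V i).1 := fun i hi => hy ((hmem y).2 ⟨i, hi⟩)
    choose f hfN hfV hfy using fun i =>
      exists_mem_affineFunctions_pow_ne_zero (V i) (hV i).1 (hV i).2 (hyV i)
    -- One equation per component, multiplied together; this is why `D` is the sum of the degrees.
    refine ⟨∏ i, f i, ⟨?_, (Submodule.mem_iInf _).2 fun i => ?_⟩, ?_⟩
    · exact prod_mem_pow_sum _ fun i _ => hfN i
    · ext z
      simp only [AlgHom.toLinearMap_apply, restrictFun_apply, Finset.prod_apply, Pi.zero_apply]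
      exact Finset.prod_eq_zero (Finset.mem_univ i) (hfV i z.1 z.2)
    · rw [Finset.prod_apply]
      exact Finset.prod_ne_zero_iff.2 fun i _ => hfy i
  have hfin : FiniteDimensional (AlgebraicClosure K) P := finiteDimensional_affineFunctions_pow D
  have hrank : Module.finrank (AlgebraicClosure K) P ≤ Module.finrank (AlgebraicClosure K) I +
      ∑ i, ((N i + 1) ^ d i + 1) ^ D :=
    (finrank_le_finrank_add_sum P fun i =>
      (restrictFun (AlgebraicClosure K) (V i).1).toLinearMap).trans
      (Nat.add_le_add_left (Finset.sum_le_sum fun i _ =>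
        finrank_map_restrictFun_affineFunctions_pow_le (V i) (hV i).1 (hV i).2 D) _)
  obtain ⟨S, hSA, hScard, hS⟩ := exists_finset_forall_map_le
    (ρ := fun g => (actFun φ g).toLinearMap)
    (fun g h => LinearMap.ext fun f => funext fun y => by simp [act_mul])
    (LinearMap.ext fun f => funext fun y => by simp [act_one])
    (fun g => map_actFun_affineFunctions_pow_le φ g D) (inf_le_left : I ≤ P) hrank hA hAinv hA₁
  refine ⟨S, hSA, hScard, fun y ⟨g, hg⟩ => ?_⟩
  by_contra! hy
  obtain ⟨f, hf, hfg⟩ := hsep _ hg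
  -- If `S` sends `y` into `W`, evaluation at `y` kills the translates by `S`, hence all translates.
  have hle : (⨆ s ∈ S, I.map (actFun φ s).toLinearMap) ≤
      LinearMap.ker (LinearMap.proj y : ((Fin n → AlgebraicClosure K) → AlgebraicClosure K) →ₗ[
        AlgebraicClosure K] AlgebraicClosure K) := by
    refine iSup₂_le fun s hs => ?_
    rintro _ ⟨h, hh, rfl⟩
    exact hI h hh _ (hy s hs)
  exact hfg (hle (hS g (Submodule.mem_map_of_mem hf)))

end Action

end EscapeSubvar

/-! ### Counting the escaping elements. -/

theorem mainTheorem7 (r : ℕ) (d N : Fin r → ℕ) :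
    ∃ (k : ℕ) (c : ℝ), 0 < c ∧
      ∀ (K : Type*) [Field K] (n : ℕ) (G : Type*) [Group G] (φ : G →* GL (Fin n) K)
        (W : Set (Fin n → AlgebraicClosure K)), EscapeSubvar.IsVariety W → W ≠ Set.univ →
        EscapeSubvar.HasComponentInvariants W r d N →
        ∀ A : Set G, A.Finite → Subgroup.closure A = ⊤ → A⁻¹ = A → 1 ∈ A →
        ∀ x : Fin n → AlgebraicClosure K, ¬ Set.range (fun g : G => EscapeSubvar.act φ g x) ⊆ W →
          max 1 (c * (A.ncard : ℝ)) ≤ ({g : G | g ∈ A ^ k ∧ EscapeSubvar.act φ g x ∉ W}.ncard : ℝ) := by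
  classical
  set D := ∑ i, N i with hD
  set m := ∑ i, ((N i + 1) ^ d i + 1) ^ D with hm
  refine ⟨m + 1, 1 / (m + 1 : ℝ), by positivity, ?_⟩
  intro K _ n G _ φ W hW _ hinv A hAfin hA hAinv hA₁ x hx
  obtain ⟨S, hSA, hScard, hS⟩ := EscapeSubvar.exists_finset_forall_act_notMem φ hW hinv hA hAinv hA₁
  have hfin : {g : G | g ∈ A ^ (m + 1) ∧ EscapeSubvar.act φ g x ∉ W}.Finite :=
    (hAfin.toFinset ^ (m + 1)).finite_toSet.subset fun g hg => by
      rw [Finset.coe_pow, Set.Finite.coe_toFinset]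
      exact hg.1
  obtain ⟨g₀, hg₀⟩ : ∃ g : G, EscapeSubvar.act φ g x ∉ W := by
    simpa [Set.range_subset_iff] using hx
  -- The points `a x` have the same orbit as `x`: `g₀ * a⁻¹` takes `a x` out of `W`.
  choose s hsS hs using fun a : G => hS (EscapeSubvar.act φ a x)
    ⟨g₀ * a⁻¹, by rwa [← EscapeSubvar.act_mul, inv_mul_cancel_right]⟩
  have hmem : ∀ a ∈ A, s a * a ∈ {g : G | g ∈ A ^ (m + 1) ∧ EscapeSubvar.act φ g x ∉ W} :=
    fun a ha => ⟨by
      rw [pow_succ]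
      exact Set.mul_mem_mul (hSA (hsS a)) ha, by
      rw [EscapeSubvar.act_mul]
      exact hs a⟩
  have hcard : A.ncard ≤ (m + 1) *
      {g : G | g ∈ A ^ (m + 1) ∧ EscapeSubvar.act φ g x ∉ W}.ncard := by
    rw [Set.ncard_eq_toFinset_card A hAfin, Set.ncard_eq_toFinset_card _ hfin]
    refine Finset.card_le_mul_card_image_of_maps_to (f := fun a => s a * a)
      (fun a ha => ?_) (m + 1) fun g _ => ?_
    · rw [Set.Finite.mem_toFinset] at ha ⊢
      exact hmem a ha
    -- In the fibre over `g`, `a` is recovered from `s a` by `s a * a = g`, so the fibre has at most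
    -- `S.card` elements.
    · refine le_trans (Finset.card_le_card_of_injOn s (fun a _ => hsS a) fun a ha b hb hab => ?_)
        hScard
      have h1 := (Finset.mem_filter.1 ha).2
      have h2 := (Finset.mem_filter.1 hb).2
      rw [← h2, hab] at h1
      exact mul_left_cancel h1
  refine max_le ?_ ?_
  · rw [Nat.one_le_cast, Nat.one_le_iff_ne_zero, ← Nat.pos_iff_ne_zero, Set.ncard_pos hfin]
    exact ⟨_, hmem 1 hA₁⟩
  · rw [div_mul_eq_mul_div, one_mul, div_le_iff₀ (by positivity), mul_comm]
    exact_mod_cast hcard
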